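/- **Setting.** Let $X$ be a finite-dimensional real inner product space, let $\mathcal H=\{(\chi,z)\in X\times\mathbb R:\langle\chi,\chi\rangle+z^2=1,\ z\ge 0\}$ be the Poincaré hemisphere and $\mathcal E=\{z=0\}\subset\mathcal H$ its equator (the sphere at infinity). Let $\phi$ be a continuous flow on $\mathcal H$ that leaves $\mathcal E$ invariant. For a flow $\psi$, $\alpha(x)$ and $\omega(x)$ denote the limit sets, $\mathrm{Inv}(K)$ is the set of points whose whole orbit lies in $K$, and $K$ is an isolating neighbourhood of $S'$ if $K$ is compact and $\mathrm{Inv}(K)=S'\subset\mathrm{int}\,K$; $S'$ is isolated invariant if it has an isolating neighbourhood. Let $S\subset\mathcal E$ be closed and invariant, and assume that its dynamical complement $S_{comp}=\{x\in\mathcal H:\alpha(x)\cap S=\omega(x)\cap S=\emptyset\}$ is isolated invariant. **Extension.** For $B\subset \mathcal H$ let $B^-$ (resp. $B^+$) be the set of $x\in B$ such that for every $\varepsilon>0$ there is $t\in(0,\varepsilon)$ with $\phi(t,x)\notin B$ (resp. $\phi(-t,x)\notin B$). Let $B$ be an isolating block for $S_{comp}$: $B$ is an isolating neighbourhood of $S_{comp}$,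 $B^\pm$ are closed, and $\partial B= B^+\cup B^-$. Let $r^\pm:[0,1]\times B^\pm\to B^\pm$ be strong deformation retractions onto subsets $b^\pm\subset B^\pm$ (continuous, $r^\pm(0,\cdot)=\mathrm{id}$, $r^\pm(s,x)=x$ for $x\in b^\pm$, $r^\pm(1,\cdot)\in b^\pm$) such that $r^\pm(s,\cdot)$ is injective for every $s<1$. Put $\beta^\pm=\{(s,r^\pm(s,x)):s\in[0,1],\ x\in B^\pm\}$ and let $\hat{\mathcal H}$ be the quotient of the disjoint union $B\sqcup\beta^+\sqcup\beta^-$ that identifies $(0,\xi)\in\beta^\pm$ with $\xi\in B$. With $T_+(x)=\sup\{t\ge0:\phi([0,t],x)\subset B\}$ and $T_-(x)=\inf\{t\le0:\phi([t,0],x)\subset B\}$, the extended flow is, for $x\in B$, $$\hat\phi(t,x)=\begin{cases}\phi(t,x), & T_-(x)\le t\le T_+(x),\\ \bigl(s,r^-(s,\phi(T_+(x),x))\bigr)\in\beta^-,\ s=1-e^{T_+(x)-t}, & t\ge T_+(x),\\ \bigl(s,r^+(s,\phi(T_-(x),x))\bigr)\in\beta^+,\ s=1-e^{t-T_-(x)},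 & t\le T_-(x);\end{cases}$$ for $(s,y)\in\beta^\pm$ with $s<1$ and $y=r^\pm(s,Y)$, $Y\in B^\pm$, it is $\hat\phi(t,(s,y))=\hat\phi(t\pm\log(1-s),Y)$; the points with $s=1$ are fixed. Write again $b^\pm=\{(1,r^\pm(1,x)):x\in B^\pm\}\subset\hat{\mathcal H}$, and let $\partial\hat{\mathcal H}$ consist of $B\cap\mathcal E$ and of all $(s,r^\pm(s,x))\in\beta^\pm$ with $x\in B^\pm\cap\mathcal E$. Subsets of $B$ are regarded as subsets of $\hat{\mathcal H}$. **Index.** An index pair for $S'$ under $\hat\phi$ is a pair of compact sets $N_1\subset N\subset \hat{\mathcal H}$ such that $\mathrm{cl}(N\setminus N_1)$ is an isolating neighbourhood of $S'$ and $S'\cap N_1=\emptyset$; if $x\in N_1$, $t>0$ and $\hat\phi([0,t],x)\subset N$ then $\hat\phi([0,t],x)\subset N_1$; and if $x\in N$, $t_1>0$, $\hat\phi(t_1,x)\notin N$ then there is $t_0\in[0,t_1]$ with $\hat\phi([0,t_0],x)\subset N$ and $\hat\phi(t_0,x)\in N_1$. The Conley index $h(S')$ is the triple of pointed homotopy types of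 $$\frac{N\cup\{*\}}{N_1\cup\{*\}},\qquad \frac{N\cup\{*\}}{N_1\cup(N\cap\partial\hat{\mathcal H})\cup\{*\}},\qquad \frac{(N\cap\partial\hat{\mathcal H})\cup\{*\}}{(N_1\cap\partial\hat{\mathcal H})\cup\{*\}},$$ computed from any index pair ($*$ an extra isolated point); $\vee$ is the wedge taken componentwise, and two triples are different if they differ in at least one component. An attractor–repeller decomposition $(A',R')$ of an invariant set $\hat I$ consists of a set $A'\subset\hat I$ that is the $\omega$-limit set of one of its neighbourhoods in $\hat I$ and of its dual repeller $R'=\{x\in\hat I:\omega(x)\cap A'=\emptyset\}$. **Theorem.** 1. Let $R\subset S_{comp}$ and $\hat I\supset R\cup b^-$ be isolated invariant sets of $\hat\phi$ such that $(b^-,R)$ is an attractor–repeller decomposition of $\hat I$ and $h(\hat I)\neq h(R)\vee h(b^-)$. Then there is $x\in B$ whose limit sets under the original flow $\phi$ satisfy $\alpha(x)\subset R$ and $\omega(x)\cap S\neq\emptyset$. 2. Let $A\subset S_{comp}$ and $\hat I\supset A\cup b^+$ be isolated invariant sets of $\hat\phi$ such that $(A,b^+)$ is an attractor–repeller decomposition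 of $\hat I$ and $h(\hat I)\neq h(A)\vee h(b^+)$. Then there is $x\in B$ whose limit sets under $\phi$ satisfy $\omega(x)\subset A$ and $\alpha(x)\cap S\neq\emptyset$. -/

import Mathlib

open Set Filter Topology

universe u

noncomputable section

namespace PoincareConley

/-! ### The Poincaré hemisphere -/

/-- The closed unit upper hemisphere of `X × ℝ`. -/
def Hemisphere (X : Type u) [NormedAddCommGroup X] [InnerProductSpace ℝ X] : Type u :=
  {p : X × ℝ // inner ℝ p.1 p.1 + p.2 ^ 2 = 1 ∧ 0 ≤ p.2}

instance (X : Type u) [NormedAddCommGroup X] [InnerProductSpace ℝ X] :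
    TopologicalSpace (Hemisphere X) :=
  inferInstanceAs (TopologicalSpace {p : X × ℝ // inner ℝ p.1 p.1 + p.2 ^ 2 = 1 ∧ 0 ≤ p.2})

/-- The equator of the hemisphere, that is, the sphere at infinity. -/
def equator (X : Type u) [NormedAddCommGroup X] [InnerProductSpace ℝ X] : Set (Hemisphere X) :=
  {p | p.1.2 = 0}

/-! ### Invariant sets, attractor-repeller pairs

The notions are stated for a map `ψ : ℝ → Y → Y`, and are used when `ψ` is a flow. -/

section Invariance

variable {Y : Type u} [TopologicalSpace Y]

/-- The maximal invariant subset of `K`: the points whose whole orbit lies in `K`. -/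
def Inv (ψ : ℝ → Y → Y) (K : Set Y) : Set Y := {x | ∀ t, ψ t x ∈ K}

/-- `K` is an isolating neighbourhood of `S`: it is compact, its maximal invariant subset is `S`,
and `S` lies in its interior. -/
structure IsIsolatingNhd (ψ : ℝ → Y → Y) (K S : Set Y) : Prop where
  isCompact : IsCompact K
  inv_eq : Inv ψ K = S
  subset_interior : S ⊆ interior K

def IsIsolatedInvariant (ψ : ℝ → Y → Y) (S : Set Y) : Prop := ∃ K, IsIsolatingNhd ψ K S

def alphaLim (ψ : ℝ → Y → Y) (x : Y) : Set Y := omegaLimit atBot ψ {x}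

def omegaLim (ψ : ℝ → Y → Y) (x : Y) : Set Y := omegaLimit atTop ψ {x}

/-- The dynamical complement of `S`: the points whose `α`- and `ω`-limit sets both miss `S`. -/
def dynComplement (ψ : ℝ → Y → Y) (S : Set Y) : Set Y :=
  {x | alphaLim ψ x ∩ S = ∅ ∧ omegaLim ψ x ∩ S = ∅}

/-- `(A, R)` is an attractor-repeller decomposition of the invariant set `I`: some neighbourhood
of `A` relative to `I` has `A` as its `ω`-limit set, and `R` is the dual repeller of `A` in `I`. -/
structure IsAttractorRepeller (ψ : ℝ → Y → Y) (I A R : Set Y) : Prop where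
  subset : A ⊆ I
  attractor : ∃ U, IsOpen U ∧ A ⊆ U ∧ omegaLimit atTop ψ (U ∩ I) = A
  repeller : R = {x | x ∈ I ∧ omegaLim ψ x ∩ A = ∅}

/-- `(N, N₁)` is an index pair for `S`. -/
structure IsIndexPair (ψ : ℝ → Y → Y) (S N N₁ : Set Y) : Prop where
  isCompact : IsCompact N
  isCompact_exit : IsCompact N₁
  subset : N₁ ⊆ N
  isolation : IsIsolatingNhd ψ (closure (N \ N₁)) S
  disjoint : Disjoint S N₁
  positively_invariant : ∀ x ∈ N₁, ∀ t, 0 < t → (∀ s ∈ Icc 0 t, ψ s x ∈ N) →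
    ∀ s ∈ Icc 0 t, ψ s x ∈ N₁
  exits_through : ∀ x ∈ N, ∀ t₁, 0 < t₁ → ψ t₁ x ∉ N →
    ∃ t₀ ∈ Icc 0 t₁, (∀ s ∈ Icc 0 t₀, ψ s x ∈ N) ∧ ψ t₀ x ∈ N₁

end Invariance

/-! ### Pointed spaces and the Conley index -/

structure PointedSpace where
  carrier : Type u
  [top : TopologicalSpace carrier]
  pt : carrier

attribute [instance] PointedSpace.top

/-- Pointed homotopy equivalence, i.e. equality of pointed homotopy types. -/
def PointedSpace.HEquiv (P Q : PointedSpace.{u}) : Prop :=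
  ∃ (f : C(P.carrier, Q.carrier)) (g : C(Q.carrier, P.carrier)), f P.pt = Q.pt ∧ g Q.pt = P.pt ∧
    (g.comp f).HomotopicRel (ContinuousMap.id _) {P.pt} ∧
    (f.comp g).HomotopicRel (ContinuousMap.id _) {Q.pt}

inductive WedgeRel (P Q : PointedSpace.{u}) : P.carrier ⊕ Q.carrier → P.carrier ⊕ Q.carrier → Prop
  | glue : WedgeRel P Q (Sum.inl P.pt) (Sum.inr Q.pt)

/-- The wedge sum of two pointed spaces. -/
def PointedSpace.wedge (P Q : PointedSpace.{u}) : PointedSpace.{u} where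
  carrier := Quot (WedgeRel P Q)
  pt := Quot.mk _ (Sum.inl P.pt)

inductive CollapseRel {Y : Type u} (N N₁ : Set Y) :
    ↥N ⊕ PUnit.{u + 1} → ↥N ⊕ PUnit.{u + 1} → Prop
  | collapse (a : ↥N) (ha : a.1 ∈ N₁) : CollapseRel N N₁ (Sum.inl a) (Sum.inr PUnit.unit)

/-- The pointed space `(N ∪ {*}) / (N₁ ∪ {*})`, where `*` is an extra isolated point. -/
def collapse {Y : Type u} [TopologicalSpace Y] (N N₁ : Set Y) : PointedSpace.{u} where
  carrier := Quot (CollapseRel N N₁)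
  pt := Quot.mk _ (Sum.inr PUnit.unit)

/-- Triples of pointed spaces: the values of the Conley index on a space with boundary, namely the
index in the space, in the space relative to its boundary, and in the boundary. -/
structure IndexTriple where
  whole : PointedSpace.{u}
  relative : PointedSpace.{u}
  boundary : PointedSpace.{u}

/-- Equality of the three pointed homotopy types. -/
def IndexTriple.HEquiv (h k : IndexTriple.{u}) : Prop :=
  h.whole.HEquiv k.whole ∧ h.relative.HEquiv k.relative ∧ h.boundary.HEquiv k.boundary

def IndexTriple.wedge (h k : IndexTriple.{u}) : IndexTriple.{u} where
  whole := h.whole.wedge k.whole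
  relative := h.relative.wedge k.relative
  boundary := h.boundary.wedge k.boundary

/-- The three quotients attached to a pair `(N, N₁)` in a space with boundary `E`. -/
def indexTriple {Y : Type u} [TopologicalSpace Y] (E N N₁ : Set Y) : IndexTriple.{u} where
  whole := collapse N N₁
  relative := collapse N (N₁ ∪ (N ∩ E))
  boundary := collapse (N ∩ E) (N₁ ∩ E)

/-- The triple `h` represents the Conley index of `S` in the space `Y` with boundary `E`. -/
def IsConleyIndex {Y : Type u} [TopologicalSpace Y] (ψ : ℝ → Y → Y) (E S : Set Y)
    (h : IndexTriple.{u}) : Prop :=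
  ∃ N N₁, IsIndexPair ψ S N N₁ ∧ h.HEquiv (indexTriple E N N₁)

/-! ### Isolating blocks -/

section Blocks

variable {Y : Type u} [TopologicalSpace Y]

/-- The immediate exit set `B⁻`. -/
def exitSet (φ : Flow ℝ Y) (B : Set Y) : Set Y :=
  {x | x ∈ B ∧ ∀ ε, 0 < ε → ∃ t, 0 < t ∧ t < ε ∧ φ t x ∉ B}

/-- The immediate entrance set `B⁺`. -/
def entranceSet (φ : Flow ℝ Y) (B : Set Y) : Set Y :=
  {x | x ∈ B ∧ ∀ ε, 0 < ε → ∃ t, 0 < t ∧ t < ε ∧ φ (-t) x ∉ B}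

/-- `B` is an isolating block: `B` is compact, its immediate entrance and exit sets are closed, and
they cover its boundary (there are no interior tangencies). -/
structure IsIsolatingBlock (φ : Flow ℝ Y) (B : Set Y) : Prop where
  isCompact : IsCompact B
  isClosed : IsClosed B
  isClosed_entrance : IsClosed (entranceSet φ B)
  isClosed_exit : IsClosed (exitSet φ B)
  frontier_subset : frontier B ⊆ entranceSet φ B ∪ exitSet φ B

/-- A strong deformation retraction `r` of `P` onto a subset `core`, where `r (s, ·)` is
injective for `s < 1`. -/
structure InjRetraction (P : Set Y) where
  core : Set Y
  r : C(unitInterval × ↥P, ↥P)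
  core_subset : core ⊆ P
  r_zero : ∀ x, r (0, x) = x
  r_core : ∀ s (x : ↥P), x.1 ∈ core → r (s, x) = x
  r_one : ∀ x, (r (1, x)).1 ∈ core
  inj : ∀ s, s < 1 → ∀ x₁ x₂, r (s, x₁) = r (s, x₂) → x₁ = x₂

/-- The collar `β = {(s, r (s, x)) : s ∈ [0,1], x ∈ P}`. -/
def InjRetraction.collar {P : Set Y} (ρ : InjRetraction P) : Set (unitInterval × Y) :=
  {q | ∃ x : ↥P, (ρ.r (q.1, x)).1 = q.2}

/-- The exit time `T₊(x) = sup {t ≥ 0 : φ([0,t], x) ⊆ B}`, used only where it is finite. -/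
def exitTime (φ : Flow ℝ Y) (B : Set Y) (x : Y) : ℝ :=
  sSup {t | 0 ≤ t ∧ ∀ s ∈ Icc 0 t, φ s x ∈ B}

/-- The entrance time `T₋(x) = inf {t ≤ 0 : φ([t,0], x) ⊆ B}`, used only where it is finite. -/
def entranceTime (φ : Flow ℝ Y) (B : Set Y) (x : Y) : ℝ :=
  sInf {t | t ≤ 0 ∧ ∀ s ∈ Icc t 0, φ s x ∈ B}

theorem exitTime_spec {φ : Flow ℝ Y} {B : Set Y} (hB : IsClosed B) {x : Y} (hx : x ∈ B) {t : ℝ}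
    (h : ¬ ∀ s ∈ Icc 0 t, φ s x ∈ B) :
    exitTime φ B x ≤ t ∧ φ (exitTime φ B x) x ∈ exitSet φ B := by
  set A : Set ℝ := {t | 0 ≤ t ∧ ∀ s ∈ Icc 0 t, φ s x ∈ B} with hA
  have hub : ∀ a ∈ A, a ≤ t := fun a ha => by
    by_contra hlt
    exact h fun s hs => ha.2 s ⟨hs.1, hs.2.trans (not_le.1 hlt).le⟩
  have hbdd : BddAbove A := ⟨t, hub⟩
  have h0 : (0 : ℝ) ∈ A := ⟨le_rfl, fun s hs => by
    have : s = 0 := le_antisymm hs.2 hs.1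
    simpa [this] using hx⟩
  have hT0 : 0 ≤ sSup A := le_csSup hbdd h0
  have hlt : ∀ s, 0 ≤ s → s < sSup A → φ s x ∈ B := fun s hs0 hs => by
    obtain ⟨a, ha, hsa⟩ := exists_lt_of_lt_csSup ⟨0, h0⟩ hs
    exact ha.2 s ⟨hs0, hsa.le⟩
  have hcont : Continuous fun s : ℝ => φ s x := φ.continuous continuous_id continuous_const
  have hTB : φ (sSup A) x ∈ B := by
    rcases hT0.eq_or_lt with h1 | h1
    · rw [← h1]; simpa using hx
    · have hcl : sSup A ∈ closure (Ioo 0 (sSup A)) := by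
        rw [closure_Ioo h1.ne]; exact ⟨hT0, le_rfl⟩
      have := map_mem_closure hcont hcl (t := B) fun s hs => hlt s hs.1.le hs.2
      rwa [hB.closure_eq] at this
  change sSup A ≤ t ∧ φ (sSup A) x ∈ exitSet φ B
  refine ⟨csSup_le ⟨0, h0⟩ hub, hTB, fun ε hε => ?_⟩
  by_contra! hno
  have : sSup A + ε / 2 ∈ A := ⟨by linarith, fun s hs => by
    rcases lt_trichotomy s (sSup A) with h1 | h1 | h1
    · exact hlt s hs.1 h1
    · rw [h1]; exact hTB
    · have := hno (s - sSup A) (by linarith) (by linarith [hs.2])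
      rw [← φ.map_add] at this
      simpa using this⟩
  linarith [le_csSup hbdd this]

theorem entranceTime_spec {φ : Flow ℝ Y} {B : Set Y} (hB : IsClosed B) {x : Y} (hx : x ∈ B)
    {t : ℝ} (h : ¬ ∀ s ∈ Icc t 0, φ s x ∈ B) :
    t ≤ entranceTime φ B x ∧ φ (entranceTime φ B x) x ∈ entranceSet φ B := by
  set A : Set ℝ := {t | t ≤ 0 ∧ ∀ s ∈ Icc t 0, φ s x ∈ B} with hA
  have hlb : ∀ a ∈ A, t ≤ a := fun a ha => by
    by_contra hlt
    exact h fun s hs => ha.2 s ⟨(not_le.1 hlt).le.trans hs.1, hs.2⟩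
  have hbdd : BddBelow A := ⟨t, hlb⟩
  have h0 : (0 : ℝ) ∈ A := ⟨le_rfl, fun s hs => by
    have : s = 0 := le_antisymm hs.2 hs.1
    simpa [this] using hx⟩
  have hT0 : sInf A ≤ 0 := csInf_le hbdd h0
  have hlt : ∀ s, s ≤ 0 → sInf A < s → φ s x ∈ B := fun s hs0 hs => by
    obtain ⟨a, ha, hsa⟩ := exists_lt_of_csInf_lt ⟨0, h0⟩ hs
    exact ha.2 s ⟨hsa.le, hs0⟩
  have hcont : Continuous fun s : ℝ => φ s x := φ.continuous continuous_id continuous_const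
  have hTB : φ (sInf A) x ∈ B := by
    rcases hT0.eq_or_lt with h1 | h1
    · rw [h1]; simpa using hx
    · have hcl : sInf A ∈ closure (Ioo (sInf A) 0) := by
        rw [closure_Ioo h1.ne]; exact ⟨le_rfl, hT0⟩
      have := map_mem_closure hcont hcl (t := B) fun s hs => hlt s hs.2.le hs.1
      rwa [hB.closure_eq] at this
  change t ≤ sInf A ∧ φ (sInf A) x ∈ entranceSet φ B
  refine ⟨le_csInf ⟨0, h0⟩ hlb, hTB, fun ε hε => ?_⟩
  by_contra! hno
  have : sInf A - ε / 2 ∈ A := ⟨by linarith, fun s hs => by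
    rcases lt_trichotomy s (sInf A) with h1 | h1 | h1
    · have := hno (sInf A - s) (by linarith) (by linarith [hs.1])
      rw [← φ.map_add] at this
      simpa using this
    · rw [h1]; exact hTB
    · exact hlt s hs.2 h1⟩
  linarith [csInf_le hbdd this]

/-! ### The extended phase space and the extended flow -/

/-- The choices on which the extension depends: an isolating block `B` and injective strong
deformation retractions of `B⁺` and of `B⁻`. -/
structure ErsatzData (φ : Flow ℝ Y) where
  B : Set Y
  block : IsIsolatingBlock φ B
  retrIn : InjRetraction (entranceSet φ B)
  retrOut : InjRetraction (exitSet φ B)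

namespace ErsatzData

variable {φ : Flow ℝ Y} (D : ErsatzData φ)

/-- The disjoint union of `B`, `β⁺` and `β⁻`. -/
abbrev Pieces : Type u := ↥D.B ⊕ (↥D.retrIn.collar ⊕ ↥D.retrOut.collar)

/-- The gluing of `(0, ξ)` in `β⁺` or `β⁻` to the point `ξ` of `B`. -/
inductive Glue : D.Pieces → D.Pieces → Prop
  | entrance (q : ↥D.retrIn.collar) (ξ : ↥D.B) (h0 : q.1.1 = 0) (h : q.1.2 = ξ.1) :
      Glue (Sum.inr (Sum.inl q)) (Sum.inl ξ)
  | exit (q : ↥D.retrOut.collar) (ξ : ↥D.B) (h0 : q.1.1 = 0) (h : q.1.2 = ξ.1) :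
      Glue (Sum.inr (Sum.inr q)) (Sum.inl ξ)

/-- The extended phase space, with the quotient topology. -/
def Ext : Type u := Quot D.Glue

instance : TopologicalSpace D.Ext := inferInstanceAs (TopologicalSpace (Quot D.Glue))

/-- The inclusion of `B`. -/
def inB (x : ↥D.B) : D.Ext := Quot.mk _ (Sum.inl x)

/-- The point `(s, r⁺(s, x))` of `β⁺`. -/
def inEntrance (s : unitInterval) (x : ↥(entranceSet φ D.B)) : D.Ext :=
  Quot.mk _ (Sum.inr (Sum.inl ⟨(s, (D.retrIn.r (s, x)).1), x, rfl⟩))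

/-- The point `(s, r⁻(s, x))` of `β⁻`. -/
def inExit (s : unitInterval) (x : ↥(exitSet φ D.B)) : D.Ext :=
  Quot.mk _ (Sum.inr (Sum.inr ⟨(s, (D.retrOut.r (s, x)).1), x, rfl⟩))

/-- The subset of the extended phase space corresponding to a subset of `B`. -/
def lift (R : Set Y) : Set D.Ext := {p | ∃ x : ↥D.B, x.1 ∈ R ∧ p = D.inB x}

/-- The ersatz infinity `b⁺`, placed at the end `s = 1` of `β⁺`. -/
def bPlus : Set D.Ext := range (D.inEntrance 1)

/-- The ersatz infinity `b⁻`, placed at the end `s = 1` of `β⁻`. -/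
def bMinus : Set D.Ext := range (D.inExit 1)

/-- The boundary of the extended phase space that a boundary `E` of the original one induces:
the part of `B` in `E` and the parts of `β⁺` and `β⁻` above `B⁺ ∩ E` and `B⁻ ∩ E`. -/
def extBoundary (E : Set Y) : Set D.Ext :=
  {p | (∃ x : ↥D.B, x.1 ∈ E ∧ p = D.inB x) ∨
    (∃ s, ∃ x : ↥(entranceSet φ D.B), x.1 ∈ E ∧ p = D.inEntrance s x) ∨
    (∃ s, ∃ x : ↥(exitSet φ D.B), x.1 ∈ E ∧ p = D.inExit s x)}

open Classical in
/-- The extended flow on points of `B`: it is the original flow as long as the orbit stays in `B`;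
at times `t ≥ T₊(x)` it is `(s, r⁻(s, φ(T₊(x), x)))` with `s = 1 - exp (T₊(x) - t)`, and at times
`t ≤ T₋(x)` it is `(s, r⁺(s, φ(T₋(x), x)))` with `s = 1 - exp (t - T₋(x))`. -/
def flowB (t : ℝ) (x : ↥D.B) : D.Ext :=
  if ht : 0 ≤ t then
    if h : ∀ s ∈ Icc 0 t, φ s x.1 ∈ D.B then
      D.inB ⟨φ t x.1, h t ⟨ht, le_rfl⟩⟩
    else
      D.inExit
        ⟨1 - Real.exp (exitTime φ D.B x.1 - t), by
          have h1 := (exitTime_spec D.block.isClosed x.2 h).1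
          have h2 := Real.exp_le_one_iff.2 (sub_nonpos.2 h1)
          exact ⟨by linarith, by linarith [Real.exp_pos (exitTime φ D.B x.1 - t)]⟩⟩
        ⟨φ (exitTime φ D.B x.1) x.1, (exitTime_spec D.block.isClosed x.2 h).2⟩
  else
    if h : ∀ s ∈ Icc t 0, φ s x.1 ∈ D.B then
      D.inB ⟨φ t x.1, h t ⟨le_rfl, (not_le.1 ht).le⟩⟩
    else
      D.inEntrance
        ⟨1 - Real.exp (t - entranceTime φ D.B x.1), by
          have h1 := (entranceTime_spec D.block.isClosed x.2 h).1
          have h2 := Real.exp_le_one_iff.2 (sub_nonpos.2 h1)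
          exact ⟨by linarith, by linarith [Real.exp_pos (t - entranceTime φ D.B x.1)]⟩⟩
        ⟨φ (entranceTime φ D.B x.1) x.1,
          (entranceTime_spec D.block.isClosed x.2 h).2⟩

/-- For `q = (s, y)` in `β⁺` with `s < 1`, the unique point `x` of `B⁺` with `r⁺(s, x) = y`. -/
def originIn (q : ↥D.retrIn.collar) : ↥D.B := ⟨q.2.choose.1, q.2.choose.2.1⟩

/-- For `q = (s, y)` in `β⁻` with `s < 1`, the unique point `x` of `B⁻` with `r⁻(s, x) = y`. -/
def originOut (q : ↥D.retrOut.collar) : ↥D.B := ⟨q.2.choose.1, q.2.choose.2.1⟩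

open Classical in
/-- The extended flow on the three pieces: a point `(s, y)` with `s < 1` of `β⁺` (of `β⁻`) is the
point reached from its origin at time `log (1 - s)` (at time `-log (1 - s)`); the points with
`s = 1` are at rest. -/
def flowPieces (t : ℝ) : D.Pieces → D.Ext
  | Sum.inl x => D.flowB t x
  | Sum.inr (Sum.inl q) =>
      if q.1.1 = 1 then Quot.mk _ (Sum.inr (Sum.inl q))
      else D.flowB (t + Real.log (1 - (q.1.1 : ℝ))) (D.originIn q)
  | Sum.inr (Sum.inr q) =>
      if q.1.1 = 1 then Quot.mk _ (Sum.inr (Sum.inr q))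
      else D.flowB (t - Real.log (1 - (q.1.1 : ℝ))) (D.originOut q)

theorem originIn_eq (q : ↥D.retrIn.collar) (ξ : ↥D.B) (h0 : q.1.1 = 0) (h : q.1.2 = ξ.1) :
    D.originIn q = ξ := by
  have h2 : ∀ s c, s = 0 → D.retrIn.r (s, c) = c := by
    rintro _ c rfl
    exact D.retrIn.r_zero c
  have h1 := q.2.choose_spec
  rw [h2 _ _ h0] at h1
  exact Subtype.ext (h1.trans h)

theorem originOut_eq (q : ↥D.retrOut.collar) (ξ : ↥D.B) (h0 : q.1.1 = 0) (h : q.1.2 = ξ.1) :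
    D.originOut q = ξ := by
  have h2 : ∀ s c, s = 0 → D.retrOut.r (s, c) = c := by
    rintro _ c rfl
    exact D.retrOut.r_zero c
  have h1 := q.2.choose_spec
  rw [h2 _ _ h0] at h1
  exact Subtype.ext (h1.trans h)

theorem flowPieces_glue (t : ℝ) (a b : D.Pieces) (hab : D.Glue a b) :
    D.flowPieces t a = D.flowPieces t b := by
  cases hab with
  | entrance q ξ h0 h => simp [flowPieces, h0, D.originIn_eq q ξ h0 h]
  | exit q ξ h0 h => simp [flowPieces, h0, D.originOut_eq q ξ h0 h]

/-- The extended flow. -/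
def extFlow (t : ℝ) : D.Ext → D.Ext := Quot.lift (D.flowPieces t) (D.flowPieces_glue t)

end ErsatzData

end Blocks

end PoincareConley

end

open PoincareConley

/-!
Suppose that no point of `B` has the limit behaviour claimed. An orbit of the extended flow in `Î`
that belongs neither to the attractor nor to the repeller runs from the repeller to the attractor.
It passes through `B`, and it leaves `B` on the side of `b⁻` (or of `b⁺`), so it does not lie in
`S_comp = Inv B`; one of its limit sets under the original flow is in `S_comp`, hence misses `S`,
and the other one must meet `S`. This is the orbit that was excluded
(`ErsatzData.exists_connection_out`, `ErsatzData.exists_connection_in`). Therefore `Î` is the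
disjoint union of the attractor and the repeller, and its Conley index is the wedge of their indices
(`IsConleyIndex.hEquiv_wedge`), contrary to the hypothesis.

Two theories carry the argument.

The first is the invariance of the Conley index, in a form that treats the three components of the
index triple at once: each of them is a quotient `A / A₁` of a `FlowPair`, obtained by intersecting
an index pair with a closed invariant set and enlarging its exit set by another one. If long orbit
segments in `A \ A₁` have their midpoints in `B \ B₁` and conversely, then `x ↦ φ (3T, x)`, defined
where the orbit stays in `A \ A₁` during `[0, 2T]` and in `B \ B₁` during `[T, 3T]`, and `*`
elsewhere, is a homotopy equivalence (`FlowPair.collapse_hEquiv`): the composition with the map in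
the other direction is the time `6T` map, which is deformed to the identity along the flow. For
disjoint isolated invariant sets the pairs are shrunk until they are disjoint
(`FlowPair.exists_localized`); the quotient of the union is then the wedge of the quotients, and it
is compared with a given index pair of the union by the same theorem.

The second is that the extended flow is a continuous flow on a compact Hausdorff space
(`ErsatzData.flow`). The space embeds into `Y × ℝ`. For the flow it suffices that its graph is
closed, as the space is compact. The relation `ErsatzData.IsAt` describes orbits through `B` by
closed conditions with parameters in compact spaces, because `B` and its entrance and exit sets are
closed; the exit time, which is not continuous where it is infinite, does not occur in it.
-/

noncomputable section

namespace PoincareConley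

/-! ### Pointed homotopy equivalence and wedge sums -/

namespace PointedSpace

variable {P Q R P' Q' : PointedSpace.{u}}

theorem HEquiv.symm (h : P.HEquiv Q) : Q.HEquiv P := by
  obtain ⟨f, g, hf, hg, h1, h2⟩ := h
  exact ⟨g, f, hg, hf, h2, h1⟩

theorem HEquiv.trans (h : P.HEquiv Q) (k : Q.HEquiv R) : P.HEquiv R := by
  obtain ⟨f, g, hf, hg, ⟨h1⟩, ⟨h2⟩⟩ := h
  obtain ⟨f', g', hf', hg', ⟨k1⟩, ⟨k2⟩⟩ := k
  refine ⟨f'.comp f, g.comp g', by simp [hf, hf'], by simp [hg, hg'], ?_, ?_⟩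
  · have e : ((g.comp (g'.comp f')).comp f).HomotopicRel ((g.comp (.id _)).comp f) {P.pt} := by
      refine ⟨⟨⟨⟨fun q => g (k1 (q.1, f q.2)), by fun_prop⟩, by simp, by simp⟩, ?_⟩⟩
      intro t x hx
      have hx' : x = P.pt := hx
      have : k1 (t, Q.pt) = Q.pt := by
        have := k1.eq_fst t (mem_singleton Q.pt)
        rw [this]; simp [hf', hg']
      simp [hx', hf, this, hg, hf', hg']
    exact e.trans ⟨h1⟩
  · have e : ((f'.comp (f.comp g)).comp g').HomotopicRel ((f'.comp (.id _)).comp g') {R.pt} := by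
      refine ⟨⟨⟨⟨fun q => f' (h2 (q.1, g' q.2)), by fun_prop⟩, by simp, by simp⟩, ?_⟩⟩
      intro t x hx
      have hx' : x = R.pt := hx
      have : h2 (t, Q.pt) = Q.pt := by
        have := h2.eq_fst t (mem_singleton Q.pt)
        rw [this]; simp [hf, hg]
      simp [hx', hg', this, hg, hf', hf]
    exact e.trans ⟨k2⟩

/-- A pointed homeomorphism is a pointed homotopy equivalence. -/
theorem HEquiv.of_inverse (f : P.carrier → Q.carrier) (g : Q.carrier → P.carrier)
    (hf : Continuous f) (hg : Continuous g) (hpt : f P.pt = Q.pt)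
    (hgf : ∀ x, g (f x) = x) (hfg : ∀ y, f (g y) = y) : P.HEquiv Q := by
  refine ⟨⟨f, hf⟩, ⟨g, hg⟩, hpt, by rw [← hpt]; exact hgf _, ?_, ?_⟩
  · rw [show (ContinuousMap.mk g hg).comp ⟨f, hf⟩ = .id _ from ContinuousMap.ext hgf]
    exact .refl _
  · rw [show (ContinuousMap.mk f hf).comp ⟨g, hg⟩ = .id _ from ContinuousMap.ext hfg]
    exact .refl _

/-- The inclusion of the first summand. -/
def wedgeInl (P Q : PointedSpace.{u}) (x : P.carrier) : (P.wedge Q).carrier :=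
  Quot.mk _ (Sum.inl x)

/-- The inclusion of the second summand. -/
def wedgeInr (P Q : PointedSpace.{u}) (x : Q.carrier) : (P.wedge Q).carrier :=
  Quot.mk _ (Sum.inr x)

theorem continuous_wedgeInl : Continuous (wedgeInl P Q) :=
  continuous_quot_mk.comp continuous_inl

theorem continuous_wedgeInr : Continuous (wedgeInr P Q) :=
  continuous_quot_mk.comp continuous_inr

theorem wedgeInl_pt : wedgeInl P Q P.pt = (P.wedge Q).pt := rfl

theorem wedgeInr_pt : wedgeInr P Q Q.pt = (P.wedge Q).pt := (Quot.sound WedgeRel.glue).symm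

theorem wedge_ind {p : (P.wedge Q).carrier → Prop} (h1 : ∀ x, p (wedgeInl P Q x))
    (h2 : ∀ x, p (wedgeInr P Q x)) (z) : p z :=
  Quot.ind (fun z => Sum.rec h1 h2 z) z

section

variable {T : Type*} (f : P.carrier → T) (g : Q.carrier → T) (h : f P.pt = g Q.pt)

/-- The map out of a wedge sum given by two maps that agree at the base points. -/
def wedgeDesc : (P.wedge Q).carrier → T :=
  Quot.lift (Sum.elim f g) (by rintro _ _ ⟨⟩; exact h)

@[simp] theorem wedgeDesc_inl (x) : wedgeDesc f g h (wedgeInl P Q x) = f x := rfl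

@[simp] theorem wedgeDesc_inr (x) : wedgeDesc f g h (wedgeInr P Q x) = g x := rfl

theorem continuous_wedgeDesc [TopologicalSpace T] (hf : Continuous f) (hg : Continuous g) :
    Continuous (wedgeDesc f g h) :=
  continuous_quot_lift _ (hf.sumElim hg)

end

/-- The wedge sum of two pointed maps. -/
def wedgeMap (f : C(P.carrier, P'.carrier)) (g : C(Q.carrier, Q'.carrier)) (hf : f P.pt = P'.pt)
    (hg : g Q.pt = Q'.pt) : C((P.wedge Q).carrier, (P'.wedge Q').carrier) where
  toFun := wedgeDesc (wedgeInl P' Q' ∘ f) (wedgeInr P' Q' ∘ g)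
    (by simp [hf, hg, wedgeInl_pt, wedgeInr_pt])
  continuous_toFun := continuous_wedgeDesc _ _ _ (continuous_wedgeInl.comp f.continuous)
    (continuous_wedgeInr.comp g.continuous)

theorem wedgeMap_homotopic_id (f : C(P.carrier, P.carrier)) (g : C(Q.carrier, Q.carrier))
    (hf : f P.pt = P.pt) (hg : g Q.pt = Q.pt) (F : f.HomotopyRel (.id _) {P.pt})
    (G : g.HomotopyRel (.id _) {Q.pt}) :
    (wedgeMap f g hf hg).HomotopicRel (.id _) {(P.wedge Q).pt} := by
  have hF : ∀ t, F (t, P.pt) = P.pt := fun t => by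
    rw [F.eq_fst t (mem_singleton _)]; exact hf
  have hG : ∀ t, G (t, Q.pt) = Q.pt := fun t => by
    rw [G.eq_fst t (mem_singleton _)]; exact hg
  let F' : C(P.carrier, C(unitInterval, (P.wedge Q).carrier)) :=
    ContinuousMap.curry ⟨fun q => wedgeInl P Q (F (q.2, q.1)),
      continuous_wedgeInl.comp (by fun_prop)⟩
  let G' : C(Q.carrier, C(unitInterval, (P.wedge Q).carrier)) :=
    ContinuousMap.curry ⟨fun q => wedgeInr P Q (G (q.2, q.1)),
      continuous_wedgeInr.comp (by fun_prop)⟩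
  have hFG : F' P.pt = G' Q.pt := by
    ext t
    change wedgeInl P Q (F (t, P.pt)) = wedgeInr P Q (G (t, Q.pt))
    rw [hF, hG, wedgeInl_pt, wedgeInr_pt]
  have hc := continuous_wedgeDesc F' G' hFG F'.continuous G'.continuous
  refine ⟨⟨⟨⟨fun q => wedgeDesc F' G' hFG q.2 q.1, by fun_prop⟩, ?_, ?_⟩, ?_⟩⟩
  · refine wedge_ind (fun x => ?_) fun x => ?_
    · change wedgeInl P Q (F (0, x)) = wedgeInl P Q (f x)
      simp
    · change wedgeInr P Q (G (0, x)) = wedgeInr P Q (g x)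
      simp
  · refine wedge_ind (fun x => ?_) fun x => ?_
    · change wedgeInl P Q (F (1, x)) = wedgeInl P Q x
      simp
    · change wedgeInr P Q (G (1, x)) = wedgeInr P Q x
      simp
  · rintro t _ rfl
    change wedgeInl P Q (F (t, P.pt)) = wedgeInl P Q (f P.pt)
    rw [hF, hf]

theorem HEquiv.wedge (h : P.HEquiv P') (k : Q.HEquiv Q') : (P.wedge Q).HEquiv (P'.wedge Q') := by
  obtain ⟨f, g, hf, hg, ⟨h1⟩, ⟨h2⟩⟩ := h
  obtain ⟨f', g', hf', hg', ⟨k1⟩, ⟨k2⟩⟩ := k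
  refine ⟨wedgeMap f f' hf hf', wedgeMap g g' hg hg', ?_, ?_, ?_, ?_⟩
  · change wedgeInl _ _ (f P.pt) = _
    rw [hf, wedgeInl_pt]
  · change wedgeInl _ _ (g P'.pt) = _
    rw [hg, wedgeInl_pt]
  · convert wedgeMap_homotopic_id (g.comp f) (g'.comp f') (by simp [hf, hg]) (by simp [hf', hg'])
      h1 k1 using 1
    ext z
    revert z; exact wedge_ind (fun x => rfl) (fun x => rfl)
  · convert wedgeMap_homotopic_id (f.comp g) (f'.comp g') (by simp [hf, hg]) (by simp [hf', hg'])
      h2 k2 using 1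
    ext z
    revert z; exact wedge_ind (fun x => rfl) (fun x => rfl)

end PointedSpace

/-! ### Collapsed pairs -/

section Collapse

open PointedSpace

variable {Z : Type u} [TopologicalSpace Z] {A A₁ B B₁ : Set Z}

open Classical in
/-- The class of `z` in `(A ∪ {*}) / (A₁ ∪ {*})`, with the value `*` outside `A`. -/
def toCollapse (A A₁ : Set Z) (z : Z) : (collapse A A₁).carrier :=
  if h : z ∈ A then Quot.mk _ (Sum.inl ⟨z, h⟩) else (collapse A A₁).pt

theorem toCollapse_of_mem {z : Z} (h : z ∈ A) :
    toCollapse A A₁ z = Quot.mk _ (Sum.inl ⟨z, h⟩) := dif_pos h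

theorem toCollapse_of_mem_exit {z : Z} (h : z ∈ A₁) : toCollapse A A₁ z = (collapse A A₁).pt := by
  by_cases h' : z ∈ A
  · rw [toCollapse_of_mem h']
    exact Quot.sound (CollapseRel.collapse ⟨z, h'⟩ h)
  · exact dif_neg h'

theorem continuous_toCollapse : Continuous fun z : A => toCollapse A A₁ z.1 := by
  have : (fun z : A => toCollapse A A₁ z.1) = fun z => Quot.mk _ (Sum.inl z) :=
    funext fun z => toCollapse_of_mem z.2
  rw [this]
  exact continuous_quot_mk.comp continuous_inl

theorem collapse_ind {p : (collapse A A₁).carrier → Prop} (h0 : p (collapse A A₁).pt)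
    (h : ∀ x ∈ A, p (toCollapse A A₁ x)) (z) : p z := by
  refine Quot.ind ?_ z
  rintro (x | x)
  · have := h x.1 x.2
    rwa [toCollapse_of_mem x.2] at this
  · exact h0

section Desc

variable {T : Type*} (f : A → T) (t : T) (hf : ∀ x : A, x.1 ∈ A₁ → f x = t)

/-- The map out of a collapsed pair given by a map on `A` that is constant on `A₁`. -/
def collapseDesc : (collapse A A₁).carrier → T :=
  Quot.lift (Sum.elim f fun _ => t) (by rintro _ _ ⟨x, hx⟩; exact hf x hx)

theorem collapseDesc_toCollapse {x : Z} (hx : x ∈ A) :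
    collapseDesc f t hf (toCollapse A A₁ x) = f ⟨x, hx⟩ := by
  rw [toCollapse_of_mem hx]; rfl

theorem continuous_collapseDesc [TopologicalSpace T] (hc : Continuous f) :
    Continuous (collapseDesc f t hf) :=
  continuous_quot_lift _ (hc.sumElim continuous_const)

end Desc

open Classical in
/-- Continuity criterion for a partially defined map into `A` that is sent to `*` where it is not
defined: the domain of definition is open, and a point outside it either has a neighbourhood
outside it or is mapped into `A₁`. -/
theorem continuous_toCollapse_ite {T : Type*} [TopologicalSpace T] {c : T → Prop} {g : T → Z}
    (hg : Continuous g) (hA : A₁ ⊆ A) (hcA : ∀ p, c p → g p ∈ A)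
    (hopen : ∀ p, c p → ∀ᶠ q in 𝓝 p, c q)
    (hout : ∀ p, ¬ c p → (∀ᶠ q in 𝓝 p, ¬ c q) ∨ g p ∈ A₁) :
    Continuous fun p => if c p then toCollapse A A₁ (g p) else (collapse A A₁).pt := by
  have key : ∀ p, g p ∈ A → ∀ O ∈ 𝓝 (toCollapse A A₁ (g p)),
      ∀ᶠ q in 𝓝 p, g q ∈ A → toCollapse A A₁ (g q) ∈ O := by
    intro p hp O hO
    have h1 := (continuous_toCollapse (A := A) (A₁ := A₁)).continuousAt (x := ⟨g p, hp⟩) hO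
    rw [mem_map, mem_nhds_subtype] at h1
    obtain ⟨V, hV, hVO⟩ := h1
    filter_upwards [hg.continuousAt hV] with q hq hqA
    exact hVO (show (⟨g q, hqA⟩ : A) ∈ _ from hq)
  refine continuous_iff_continuousAt.2 fun p => ?_
  by_cases hp : c p
  · intro O hO
    simp only [hp, if_true] at hO
    rw [mem_map]
    filter_upwards [hopen p hp, key p (hcA p hp) O hO] with q hq hqO
    simpa [hq] using hqO (hcA q hq)
  · rcases hout p hp with h | h
    · refine (continuousAt_const (y := (collapse A A₁).pt)).congr ?_
      filter_upwards [h] with q hq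
      simp [hq]
    · intro O hO
      simp only [hp, if_false] at hO
      rw [← toCollapse_of_mem_exit h] at hO
      rw [mem_map]
      filter_upwards [key p (hA h) O hO] with q hqO
      by_cases hq : c q
      · simpa [hq] using hqO (hcA q hq)
      · have := mem_of_mem_nhds hO
        rw [toCollapse_of_mem_exit h] at this
        simpa [hq] using this

open Classical in
/-- For disjoint closed sets, collapsing the union gives the wedge of the two collapsed pairs. -/
theorem collapse_union_hEquiv (hA : IsClosed A) (hB : IsClosed B) (hAB : Disjoint A B)
    (hA₁ : A₁ ⊆ A) (hB₁ : B₁ ⊆ B) :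
    (collapse (A ∪ B) (A₁ ∪ B₁)).HEquiv ((collapse A A₁).wedge (collapse B B₁)) := by
  set P := collapse A A₁
  set Q := collapse B B₁
  set U := collapse (A ∪ B) (A₁ ∪ B₁)
  let f : ↥(A ∪ B) → (P.wedge Q).carrier := fun x =>
    if x.1 ∈ A then wedgeInl P Q (toCollapse A A₁ x.1) else wedgeInr P Q (toCollapse B B₁ x.1)
  have hfA : ∀ x (h : x ∈ A), f ⟨x, Or.inl h⟩ = wedgeInl P Q (toCollapse A A₁ x) :=
    fun x h => if_pos h
  have hfB : ∀ x (h : x ∈ B), f ⟨x, Or.inr h⟩ = wedgeInr P Q (toCollapse B B₁ x) :=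
    fun x h => if_neg fun h' => disjoint_left.1 hAB h' h
  have hfc : Continuous f := by
    let s : Set ↥(A ∪ B) := Subtype.val ⁻¹' A
    let t : Set ↥(A ∪ B) := Subtype.val ⁻¹' B
    have hs : ContinuousOn f s := by
      rw [continuousOn_iff_continuous_domRestrict]
      have : s.domRestrict f = fun x : s =>
          wedgeInl P Q ((fun z : A => toCollapse A A₁ z.1) ⟨x.1.1, x.2⟩) :=
        funext fun x => hfA x.1.1 x.2
      rw [this]
      exact continuous_wedgeInl.comp (continuous_toCollapse.comp (by fun_prop))
    have ht : ContinuousOn f t := by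
      rw [continuousOn_iff_continuous_domRestrict]
      have : t.domRestrict f = fun x : t =>
          wedgeInr P Q ((fun z : B => toCollapse B B₁ z.1) ⟨x.1.1, x.2⟩) :=
        funext fun x => hfB x.1.1 x.2
      rw [this]
      exact continuous_wedgeInr.comp (continuous_toCollapse.comp (by fun_prop))
    have hst : s ∪ t = univ := eq_univ_of_forall fun x => x.2
    rw [← continuousOn_univ, ← hst]
    exact hs.union_of_isClosed ht (hA.preimage continuous_subtype_val)
      (hB.preimage continuous_subtype_val)
  let F : U.carrier → (P.wedge Q).carrier := collapseDesc f (P.wedge Q).pt (by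
    rintro ⟨x, _⟩ (hx | hx)
    · rw [hfA x (hA₁ hx), toCollapse_of_mem_exit hx]; exact wedgeInl_pt
    · rw [hfB x (hB₁ hx), toCollapse_of_mem_exit hx]; exact wedgeInr_pt)
  let g₁ : P.carrier → U.carrier := collapseDesc
    (fun x => toCollapse (A ∪ B) (A₁ ∪ B₁) x.1) U.pt
    (fun x hx => toCollapse_of_mem_exit (Or.inl hx))
  let g₂ : Q.carrier → U.carrier := collapseDesc
    (fun x => toCollapse (A ∪ B) (A₁ ∪ B₁) x.1) U.pt
    (fun x hx => toCollapse_of_mem_exit (Or.inr hx))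
  have hg₁ : Continuous g₁ := continuous_collapseDesc _ _ _
    ((continuous_toCollapse (A := A ∪ B)).comp (continuous_inclusion subset_union_left))
  have hg₂ : Continuous g₂ := continuous_collapseDesc _ _ _
    ((continuous_toCollapse (A := A ∪ B)).comp (continuous_inclusion subset_union_right))
  have e₁ : ∀ x ∈ A, g₁ (toCollapse A A₁ x) = toCollapse (A ∪ B) (A₁ ∪ B₁) x :=
    fun x hx => collapseDesc_toCollapse _ _ _ hx
  have e₂ : ∀ x ∈ B, g₂ (toCollapse B B₁ x) = toCollapse (A ∪ B) (A₁ ∪ B₁) x :=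
    fun x hx => collapseDesc_toCollapse _ _ _ hx
  have eF : ∀ x (hx : x ∈ A ∪ B), F (toCollapse (A ∪ B) (A₁ ∪ B₁) x) = f ⟨x, hx⟩ :=
    fun x hx => collapseDesc_toCollapse _ _ _ hx
  have hg : g₁ P.pt = g₂ Q.pt := rfl
  refine HEquiv.of_inverse F (wedgeDesc g₁ g₂ hg) (continuous_collapseDesc _ _ _ hfc)
    (continuous_wedgeDesc _ _ _ hg₁ hg₂) rfl ?_ ?_
  · refine collapse_ind rfl ?_
    rintro x (hx | hx)
    · rw [eF x (Or.inl hx), hfA x hx, wedgeDesc_inl, e₁ x hx]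
    · rw [eF x (Or.inr hx), hfB x hx, wedgeDesc_inr, e₂ x hx]
  · refine wedge_ind (collapse_ind wedgeInl_pt.symm fun x hx => ?_)
      (collapse_ind wedgeInr_pt.symm fun x hx => ?_)
    · rw [wedgeDesc_inl, e₁ x hx, eF x (Or.inl hx), hfA x hx]
    · rw [wedgeDesc_inr, e₂ x hx, eF x (Or.inr hx), hfB x hx]

end Collapse

/-! ### Pairs with an exit set, and their shrinkings -/

section FlowPair

open PointedSpace

variable {Z : Type u} [TopologicalSpace Z] {ψ : Flow ℝ Z} {A A₁ B B₁ C : Set Z} {T : ℝ}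

theorem continuous_orbit (ψ : Flow ℝ Z) (x : Z) : Continuous fun s : ℝ => ψ s x :=
  ψ.continuous continuous_id continuous_const

/-- A closed pair `(A, A₁)` such that `A₁` is positively invariant relative to `A` and orbits leave
`A` through `A₁`: an index pair without the isolation requirement. The weaker notion is inherited
by the intersections with invariant sets from which the components of the index triple arise. -/
structure FlowPair (ψ : Flow ℝ Z) (A A₁ : Set Z) : Prop where
  isClosed : IsClosed A
  isClosed_exit : IsClosed A₁
  subset : A₁ ⊆ A
  pos_inv : ∀ x ∈ A₁, ∀ t, 0 ≤ t → (∀ s ∈ Icc 0 t, ψ s x ∈ A) → ψ t x ∈ A₁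
  exits : ∀ x ∈ A, ∀ t, 0 ≤ t → ψ t x ∉ A →
    ∃ s ∈ Icc 0 t, (∀ r ∈ Icc 0 s, ψ r x ∈ A) ∧ ψ s x ∈ A₁

theorem FlowPair.mem_of_forall_notMem (h : FlowPair ψ A A₁) {x : Z} (hx : x ∈ A) {t : ℝ}
    (hA : ∀ s ∈ Icc 0 t, ψ s x ∉ A₁) : ∀ s ∈ Icc 0 t, ψ s x ∈ A \ A₁ := by
  refine fun s hs => ⟨?_, hA s hs⟩
  by_contra hn
  obtain ⟨r, hr, -, hr1⟩ := h.exits x hx s hs.1 hn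
  exact hA r ⟨hr.1, hr.2.trans hs.2⟩ hr1

theorem isOpen_forall_mem_Icc (ψ : Flow ℝ Z) {U : Set Z} (hU : IsOpen U) (a b : ℝ) :
    IsOpen {x | ∀ s ∈ Icc a b, ψ s x ∈ U} := by
  refine isOpen_iff_mem_nhds.2 fun x hx => ?_
  refine isCompact_Icc.eventually_forall_of_forall_eventually (x₀ := x)
    (P := fun y s => ψ s y ∈ U) fun s hs => ?_
  exact (ψ.continuous continuous_snd continuous_fst).continuousAt.eventually
    (hU.mem_nhds (hx s hs))

/-- The part of the pair whose past of length `T` lies in `A`, with the points that reach the exit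
set within time `T` added to the exit set. -/
theorem FlowPair.shrink (h : FlowPair ψ A A₁) (hT : 0 ≤ T) :
    FlowPair ψ {x | ∀ s ∈ Icc 0 T, ψ (-s) x ∈ A}
      {x | (∀ s ∈ Icc 0 T, ψ (-s) x ∈ A) ∧ ∃ s ∈ Icc 0 T, ψ s x ∈ A₁} := by
  have hcl : IsClosed {x | ∀ s ∈ Icc 0 T, ψ (-s) x ∈ A} := by
    simp only [ofPred_forall]
    exact isClosed_biInter fun s _ => h.isClosed.preimage (ψ.continuous_toFun _)
  have h0 : ∀ x, (∀ s ∈ Icc 0 T, ψ (-s) x ∈ A) → x ∈ A := fun x hx => by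
    simpa using hx 0 ⟨le_rfl, hT⟩
  refine ⟨hcl, hcl.inter ?_, fun x hx => hx.1, ?_, ?_⟩
  · have := (isOpen_forall_mem_Icc ψ h.isClosed_exit.isOpen_compl 0 T).isClosed_compl
    have e : {x | ∃ s ∈ Icc 0 T, ψ s x ∈ A₁} = {x | ∀ s ∈ Icc 0 T, ψ s x ∈ A₁ᶜ}ᶜ := by
      ext x
      simp [and_assoc]
    rwa [← e] at this
  · rintro x ⟨hx, s, hs, hsA⟩ t ht hst
    -- the exit set is reached at some time before which the orbit stays in `A`
    obtain ⟨s, hs, hsA, hs1⟩ : ∃ s ∈ Icc 0 T, (∀ r ∈ Icc 0 s, ψ r x ∈ A) ∧ ψ s x ∈ A₁ := by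
      by_cases hA : ∀ r ∈ Icc 0 s, ψ r x ∈ A
      · exact ⟨s, hs, hA, hsA⟩
      · push Not at hA
        obtain ⟨r, hr, hrA⟩ := hA
        obtain ⟨q, hq, hq1, hq2⟩ := h.exits x (h0 x hx) r hr.1 hrA
        exact ⟨q, ⟨hq.1, hq.2.trans (hr.2.trans hs.2)⟩, hq1, hq2⟩
    refine ⟨hst t ⟨ht, le_rfl⟩, ?_⟩
    rcases le_total t s with hts | hts
    · refine ⟨s - t, ⟨by linarith, by linarith [hs.2]⟩, ?_⟩
      rw [← ψ.map_add]
      simpa using hs1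
    · refine ⟨0, ⟨le_rfl, hT⟩, ?_⟩
      have := h.pos_inv _ hs1 (t - s) (by linarith) fun r hr => by
        rw [← ψ.map_add]
        exact h0 _ (hst (r + s) ⟨by linarith [hr.1, hs.1], by linarith [hr.2]⟩)
      rw [← ψ.map_add] at this
      simpa using this
  · intro x hx t ht htx
    simp only [mem_ofPred_eq, not_forall] at htx
    obtain ⟨s, hs, hsx⟩ := htx
    rw [← ψ.map_add] at hsx
    have hst : 0 ≤ -s + t := by
      by_contra hlt
      have := hx (s - t) ⟨by linarith, by linarith [hs.2]⟩
      rw [show -(s - t) = -s + t by ring] at this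
      exact hsx this
    obtain ⟨q, hq, hqA, hq1⟩ := h.exits x (h0 x hx) _ hst hsx
    have hm : ∀ r ∈ Icc 0 q, ∀ s ∈ Icc 0 T, ψ (-s) (ψ r x) ∈ A := by
      intro r hr s hs
      rw [← ψ.map_add]
      rcases le_total 0 (-s + r) with h1 | h1
      · exact hqA _ ⟨h1, by linarith [hr.2, hs.1]⟩
      · have := hx (s - r) ⟨by linarith, by linarith [hr.1, hs.2]⟩
        rwa [show -(s - r) = -s + r by ring] at this
    exact ⟨q, ⟨hq.1, by linarith [hq.2, hs.1]⟩, hm,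
      hm q ⟨hq.1, le_rfl⟩, 0, ⟨le_rfl, hT⟩, by simpa using hq1⟩

theorem FlowPair.inter (h : FlowPair ψ A A₁) (hC : IsClosed C) (hAC : A \ A₁ ⊆ C) :
    FlowPair ψ (A ∩ C) (A₁ ∩ C) := by
  refine ⟨h.isClosed.inter hC, h.isClosed_exit.inter hC, inter_subset_inter_left _ h.subset, ?_, ?_⟩
  · exact fun x hx t ht hs =>
      ⟨h.pos_inv x hx.1 t ht fun s hst => (hs s hst).1, (hs t ⟨ht, le_rfl⟩).2⟩
  · intro x hx t ht htx
    have hc := continuous_orbit ψ x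
    have hne : (Icc 0 t ∩ (fun s => ψ s x) ⁻¹' A₁).Nonempty := by
      by_contra hemp
      have := h.mem_of_forall_notMem hx.1 (t := t) fun s hs hs1 => hemp ⟨s, hs, hs1⟩
      have := this t ⟨ht, le_rfl⟩
      exact htx ⟨this.1, hAC this⟩
    obtain ⟨τ, ⟨hτ, hτ1⟩, hmin⟩ :=
      (isCompact_Icc.inter_right (h.isClosed_exit.preimage hc)).exists_isLeast hne
    have hlt : ∀ s ∈ Ico 0 τ, ψ s x ∈ A \ A₁ := fun s hs =>
      h.mem_of_forall_notMem hx.1 (t := s) (fun r hr hr1 =>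
        absurd (hmin ⟨⟨hr.1, hr.2.trans (hs.2.le.trans hτ.2)⟩, hr1⟩)
          (not_le.2 (hr.2.trans_lt hs.2))) s ⟨hs.1, le_rfl⟩
    have hτC : ψ τ x ∈ C := by
      rcases hτ.1.eq_or_lt with h0 | h0
      · rw [← h0]; simpa using hx.2
      · have hcl : τ ∈ closure (Ico 0 τ) := by
          rw [closure_Ico h0.ne]; exact ⟨hτ.1, le_rfl⟩
        have := map_mem_closure hc hcl (t := C) fun s hs => hAC (hlt s hs)
        rwa [hC.closure_eq] at this
    refine ⟨τ, hτ, fun r hr => ?_, hτ1, hτC⟩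
    rcases hr.2.eq_or_lt with h0 | h0
    · rw [h0]; exact ⟨h.subset hτ1, hτC⟩
    · have := hlt r ⟨hr.1, h0⟩
      exact ⟨this.1, hAC this⟩

/-- A pair can be replaced by one that lies in a given closed set `C`, provided that orbit segments
of length `2T` in `A \ A₁` have their midpoints in `C`. -/
theorem FlowPair.exists_localized (h : FlowPair ψ A A₁) (hT : 0 ≤ T) (hC : IsClosed C)
    (hAC : ∀ x, (∀ s ∈ Icc (-T) T, ψ s x ∈ A \ A₁) → x ∈ C) :
    ∃ A' A₁', FlowPair ψ A' A₁' ∧ A' ⊆ C ∧ A' \ A₁' ⊆ A \ A₁ ∧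
      ∀ x, (∀ s ∈ Icc (-T) T, ψ s x ∈ A \ A₁) → x ∈ A' \ A₁' := by
  have h0 : ∀ x, (∀ s ∈ Icc 0 T, ψ (-s) x ∈ A) → x ∈ A := fun x hx => by
    simpa using hx 0 ⟨le_rfl, hT⟩
  have key : {x | ∀ s ∈ Icc 0 T, ψ (-s) x ∈ A} \
      {x | (∀ s ∈ Icc 0 T, ψ (-s) x ∈ A) ∧ ∃ s ∈ Icc 0 T, ψ s x ∈ A₁} ⊆
      {x | ∀ s ∈ Icc (-T) T, ψ s x ∈ A \ A₁} := by
    rintro x ⟨hx, hx1⟩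
    have hx2 : ∀ s ∈ Icc 0 T, ψ s x ∉ A₁ := fun s hs hs1 => hx1 ⟨hx, s, hs, hs1⟩
    intro s hs
    rcases le_total 0 s with h1 | h1
    · exact h.mem_of_forall_notMem (h0 x hx) hx2 s ⟨h1, hs.2⟩
    · have hxs := hx (-s) ⟨by linarith, by linarith [hs.1]⟩
      rw [neg_neg] at hxs
      refine ⟨hxs, fun hs1 => hx2 0 ⟨le_rfl, hT⟩ ?_⟩
      have := h.pos_inv _ hs1 (-s) (by linarith) fun r hr => by
        have := hx (-(r + s)) ⟨by linarith [hr.2], by linarith [hr.1, hs.1]⟩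
        rwa [neg_neg, ψ.map_add] at this
      rwa [← ψ.map_add, neg_add_cancel] at this
  refine ⟨_, _, (h.shrink hT).inter hC fun x hx => hAC x (key hx), inter_subset_right, ?_, ?_⟩
  · rintro x ⟨⟨hx, hxC⟩, hx1⟩
    have := key ⟨hx, fun h1 => hx1 ⟨h1, hxC⟩⟩ 0 ⟨by linarith, hT⟩
    simpa using this
  · intro x hx
    refine ⟨⟨fun s hs => (hx _ ⟨by linarith [hs.2], by linarith [hs.1]⟩).1, hAC x hx⟩, ?_⟩
    rintro ⟨⟨-, s, hs, hs1⟩, -⟩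
    exact (hx s ⟨by linarith [hs.1], hs.2⟩).2 hs1

/-- An orbit segment in the union of two disjoint closed sets lies in one of them. -/
theorem orbit_segment_subset_or (ψ : Flow ℝ Z) (hA : IsClosed A) (hB : IsClosed B)
    (hAB : Disjoint A B) {x : Z} {a b : ℝ} (h : ∀ s ∈ Icc a b, ψ s x ∈ A ∪ B) :
    (∀ s ∈ Icc a b, ψ s x ∈ A) ∨ ∀ s ∈ Icc a b, ψ s x ∈ B := by
  have hc := continuous_orbit ψ x
  have := isPreconnected_iff_subset_of_disjoint_closed.1 (isPreconnected_Icc (a := a) (b := b))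
    _ _ (hA.preimage hc) (hB.preimage hc) h (by
      rw [← preimage_inter, hAB.inter_eq]; simp)
  exact this

theorem FlowPair.union (hA : FlowPair ψ A A₁) (hB : FlowPair ψ B B₁) (hAB : Disjoint A B) :
    FlowPair ψ (A ∪ B) (A₁ ∪ B₁) := by
  refine ⟨hA.isClosed.union hB.isClosed, hA.isClosed_exit.union hB.isClosed_exit,
    union_subset_union hA.subset hB.subset, ?_, ?_⟩
  · intro x hx t ht hs
    have h0 : ψ 0 x = x := ψ.map_zero_apply x
    rcases orbit_segment_subset_or ψ hA.isClosed hB.isClosed hAB hs with h | h <;>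
      rcases hx with hx | hx
    · exact Or.inl (hA.pos_inv x hx t ht h)
    · exact (disjoint_left.1 hAB (h0 ▸ h 0 ⟨le_rfl, ht⟩) (hB.subset hx)).elim
    · exact (disjoint_left.1 hAB (hA.subset hx) (h0 ▸ h 0 ⟨le_rfl, ht⟩)).elim
    · exact Or.inr (hB.pos_inv x hx t ht h)
  · rintro x (hx | hx) t ht htx
    · obtain ⟨s, hs, h1, h2⟩ := hA.exits x hx t ht fun h => htx (Or.inl h)
      exact ⟨s, hs, fun r hr => Or.inl (h1 r hr), Or.inl h2⟩
    · obtain ⟨s, hs, h1, h2⟩ := hB.exits x hx t ht fun h => htx (Or.inr h)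
      exact ⟨s, hs, fun r hr => Or.inr (h1 r hr), Or.inr h2⟩

/-! ### Invariance of the collapsed pair -/

/-- The midpoints of orbit segments of length `2T` in `K` lie in `L`. -/
def Dominates (ψ : Flow ℝ Z) (T : ℝ) (K L : Set Z) : Prop :=
  ∀ x, (∀ s ∈ Icc (-T) T, ψ s x ∈ K) → x ∈ L

theorem Dominates.mono {K L : Set Z} (h : Dominates ψ T K L) {T' : ℝ} (hT : T ≤ T') :
    Dominates ψ T' K L :=
  fun x hx => h x fun s hs => hx s ⟨by linarith [hs.1], hs.2.trans hT⟩

theorem Dominates.of_subset {K L : Set Z} (h : K ⊆ L) (hT : 0 ≤ T) : Dominates ψ T K L :=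
  fun x hx => h (by simpa using hx 0 ⟨by linarith, hT⟩)

theorem Dominates.forall_mem {K L : Set Z} (h : Dominates ψ T K L) {x : Z} {a b : ℝ}
    (hx : ∀ s ∈ Icc a b, ψ s x ∈ K) : ∀ s ∈ Icc (a + T) (b - T), ψ s x ∈ L := by
  refine fun s hs => h _ fun r hr => ?_
  rw [← ψ.map_add]
  exact hx _ ⟨by linarith [hr.1, hs.1], by linarith [hr.2, hs.2]⟩

/-- The points that stay in `A \ A₁` during `[0, 2T]` and in `B \ B₁` during `[T, 3T]`. -/
def transferDomain (ψ : Flow ℝ Z) (T : ℝ) (A A₁ B B₁ : Set Z) : Set Z :=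
  {x | (∀ s ∈ Icc 0 (2 * T), ψ s x ∈ A \ A₁) ∧ ∀ s ∈ Icc T (3 * T), ψ s x ∈ B \ B₁}

open Classical in
/-- The map `x ↦ φ (3T, x)` on the transfer domain, extended by `*`. -/
def transferFun (ψ : Flow ℝ Z) (T : ℝ) (A A₁ B B₁ : Set Z) (x : Z) : (collapse B B₁).carrier :=
  if x ∈ transferDomain ψ T A A₁ B B₁ then toCollapse B B₁ (ψ (3 * T) x) else (collapse B B₁).pt

theorem transferFun_of_mem {x : Z} (h : x ∈ transferDomain ψ T A A₁ B B₁) :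
    transferFun ψ T A A₁ B B₁ x = toCollapse B B₁ (ψ (3 * T) x) := if_pos h

theorem transferFun_of_notMem {x : Z} (h : x ∉ transferDomain ψ T A A₁ B B₁) :
    transferFun ψ T A A₁ B B₁ x = (collapse B B₁).pt := if_neg h

theorem transferFun_of_mem_exit (hT : 0 ≤ T) {x : Z} (hx : x ∈ A₁) :
    transferFun ψ T A A₁ B B₁ x = (collapse B B₁).pt :=
  transferFun_of_notMem fun h => (h.1 0 ⟨le_rfl, by linarith⟩).2 (by simpa using hx)

theorem continuous_transferFun (hA : FlowPair ψ A A₁) (hB : FlowPair ψ B B₁) (hT : 0 ≤ T)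
    (hAB : Dominates ψ T (A \ A₁) (B \ B₁)) (hBA : Dominates ψ T (B \ B₁) (A \ A₁)) :
    Continuous fun x : A => transferFun ψ T A A₁ B B₁ x.1 := by
  classical
  have hev : ∀ (x : A) (s : ℝ) {D : Set Z}, IsOpen D → ψ s x.1 ∈ D →
      ∀ᶠ y : A in 𝓝 x, ψ s y.1 ∈ D := fun x s D hD hx =>
    ((ψ.continuous_toFun s).comp continuous_subtype_val).continuousAt.eventually (hD.mem_nhds hx)
  refine continuous_toCollapse_ite (c := fun x : A => x.1 ∈ transferDomain ψ T A A₁ B B₁)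
    (g := fun x : A => ψ (3 * T) x.1)
    ((ψ.continuous_toFun _).comp continuous_subtype_val) hB.subset
    (fun x hx => (hx.2 (3 * T) ⟨by linarith, le_rfl⟩).1) ?_ ?_
  · intro x hx
    have h1 := (isOpen_forall_mem_Icc ψ hA.isClosed_exit.isOpen_compl 0 (2 * T)).mem_nhds
      (fun s hs => (hx.1 s hs).2)
    have h2 := (isOpen_forall_mem_Icc ψ hB.isClosed_exit.isOpen_compl T (3 * T)).mem_nhds
      (fun s hs => (hx.2 s hs).2)
    filter_upwards [continuous_subtype_val.continuousAt h1,
      continuous_subtype_val.continuousAt h2] with y hy1 hy2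
    have hyA := hA.mem_of_forall_notMem y.2 hy1
    -- at time `T` the orbit is in `B \ B₁` by domination; it stays there as it avoids `B₁`
    have hyB := hAB.forall_mem hyA T ⟨by linarith, by linarith⟩
    refine ⟨hyA, fun s hs => ?_⟩
    have := hB.mem_of_forall_notMem hyB.1 (t := 2 * T) (fun r hr => by
      rw [← ψ.map_add]
      exact hy2 _ ⟨by linarith [hr.1], by linarith [hr.2]⟩) (s - T)
      ⟨by linarith [hs.1], by linarith [hs.2]⟩
    rwa [← ψ.map_add, sub_add_cancel] at this
  · intro x hx
    by_cases h1 : ∀ s ∈ Icc 0 (2 * T), ψ s x.1 ∈ A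
    swap
    · push Not at h1
      obtain ⟨s, hs, hsA⟩ := h1
      left
      filter_upwards [hev x s hA.isClosed.isOpen_compl hsA] with y hy hyd
      exact hy (hyd.1 s hs).1
    by_cases h2 : ∀ s ∈ Icc T (3 * T), ψ s x.1 ∈ B
    swap
    · push Not at h2
      obtain ⟨s, hs, hsA⟩ := h2
      left
      filter_upwards [hev x s hB.isClosed.isOpen_compl hsA] with y hy hyd
      exact hy (hyd.2 s hs).1
    right
    by_cases h3 : ∀ s ∈ Icc T (3 * T), ψ s x.1 ∉ B₁
    · -- then the orbit meets `A₁`, hence is in `A₁` at time `2T`, contrary to domination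
      have h4 := hBA.forall_mem (fun s hs => ⟨h2 s hs, h3 s hs⟩) (2 * T)
        ⟨by linarith, by linarith⟩
      refine absurd ⟨fun s hs => ⟨h1 s hs, fun hs1 => h4.2 ?_⟩,
        fun s hs => ⟨h2 s hs, h3 s hs⟩⟩ hx
      have := hA.pos_inv _ hs1 (2 * T - s) (by linarith [hs.2]) fun r hr => by
        rw [← ψ.map_add]
        exact h1 _ ⟨by linarith [hr.1, hs.1], by linarith [hr.2]⟩
      rwa [← ψ.map_add, sub_add_cancel] at this
    · push Not at h3
      obtain ⟨s, hs, hs1⟩ := h3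
      have := hB.pos_inv _ hs1 (3 * T - s) (by linarith [hs.2]) fun r hr => by
        rw [← ψ.map_add]
        exact h2 _ ⟨by linarith [hr.1, hs.1], by linarith [hr.2]⟩
      rwa [← ψ.map_add, sub_add_cancel] at this

/-- The map of collapsed pairs that the flow induces. -/
def transfer (hA : FlowPair ψ A A₁) (hB : FlowPair ψ B B₁) (hT : 0 ≤ T)
    (hAB : Dominates ψ T (A \ A₁) (B \ B₁)) (hBA : Dominates ψ T (B \ B₁) (A \ A₁)) :
    C((collapse A A₁).carrier, (collapse B B₁).carrier) where
  toFun := collapseDesc (fun x => transferFun ψ T A A₁ B B₁ x.1) (collapse B B₁).pt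
    fun _ hx => transferFun_of_mem_exit hT hx
  continuous_toFun := continuous_collapseDesc _ _ _ (continuous_transferFun hA hB hT hAB hBA)

theorem transfer_toCollapse (hA : FlowPair ψ A A₁) (hB : FlowPair ψ B B₁) (hT : 0 ≤ T)
    (hAB : Dominates ψ T (A \ A₁) (B \ B₁)) (hBA : Dominates ψ T (B \ B₁) (A \ A₁)) {x : Z}
    (hx : x ∈ A) :
    transfer hA hB hT hAB hBA (toCollapse A A₁ x) = transferFun ψ T A A₁ B B₁ x := by
  exact collapseDesc_toCollapse (fun x : A => transferFun ψ T A A₁ B B₁ x.1) _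
    (fun x hx => transferFun_of_mem_exit hT hx) hx

open Classical in
/-- The map `x ↦ φ (t, x)` on the points that stay in `A \ A₁` during `[0, t]`, extended by `*`. -/
def pushFun (ψ : Flow ℝ Z) (A A₁ : Set Z) (t : ℝ) (x : Z) : (collapse A A₁).carrier :=
  if ∀ σ ∈ Icc (0 : ℝ) 1, ψ (σ * t) x ∈ A \ A₁ then toCollapse A A₁ (ψ t x)
  else (collapse A A₁).pt

theorem forall_unit_iff {t : ℝ} (ht : 0 ≤ t) {p : ℝ → Prop} :
    (∀ σ ∈ Icc (0 : ℝ) 1, p (σ * t)) ↔ ∀ s ∈ Icc 0 t, p s := by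
  constructor
  · intro h s hs
    rcases ht.eq_or_lt with h0 | h0
    · have := h 0 ⟨le_rfl, zero_le_one⟩
      have hs0 : s = 0 := le_antisymm (h0 ▸ hs.2) hs.1
      rwa [zero_mul, ← hs0] at this
    · have := h (s / t) ⟨div_nonneg hs.1 ht, (div_le_one h0).2 hs.2⟩
      rwa [div_mul_cancel₀ _ h0.ne'] at this
  · exact fun h σ hσ => h _ ⟨mul_nonneg hσ.1 ht, mul_le_of_le_one_left ht hσ.2⟩

theorem pushFun_zero {x : Z} (hx : x ∈ A) :
    pushFun ψ A A₁ 0 x = toCollapse A A₁ x := by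
  unfold pushFun
  split_ifs with h
  · simp
  · refine (toCollapse_of_mem_exit ?_).symm
    by_contra h1
    exact h fun σ _ => by simpa using And.intro hx h1

theorem continuous_pushFun (hA : FlowPair ψ A A₁) (hT : 0 ≤ T) :
    Continuous fun p : A × unitInterval => pushFun ψ A A₁ (p.2 * T) p.1.1 := by
  classical
  have hc : ∀ σ : ℝ, Continuous fun p : A × unitInterval => ψ (σ * (p.2 * T)) p.1.1 := fun σ =>
    ψ.continuous (by fun_prop) (by fun_prop)
  have hc1 : Continuous fun p : A × unitInterval => ψ (p.2 * T) p.1.1 :=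
    ψ.continuous (by fun_prop) (by fun_prop)
  refine continuous_toCollapse_ite
    (c := fun p : A × unitInterval => ∀ σ ∈ Icc (0 : ℝ) 1, ψ (σ * (p.2 * T)) p.1.1 ∈ A \ A₁)
    hc1 hA.subset (fun p hp => by simpa using (hp 1 ⟨zero_le_one, le_rfl⟩).1) ?_ ?_
  · intro p hp
    have : ∀ᶠ q : A × unitInterval in 𝓝 p, ∀ σ ∈ Icc (0 : ℝ) 1,
        ψ (σ * (q.2 * T)) q.1.1 ∉ A₁ := by
      refine isCompact_Icc.eventually_forall_of_forall_eventually (x₀ := p)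
        (P := fun q σ => ψ (σ * (q.2 * T)) q.1.1 ∉ A₁) fun σ hσ => ?_
      exact (ψ.continuous (by fun_prop) (by fun_prop) : Continuous
        fun z : (A × unitInterval) × ℝ => ψ (z.2 * (z.1.2 * T)) z.1.1.1).continuousAt (x := (p, σ))
        |>.eventually (hA.isClosed_exit.isOpen_compl.mem_nhds (hp σ hσ).2)
    filter_upwards [this] with q hq
    have hq0 : 0 ≤ (q.2 : ℝ) * T := mul_nonneg q.2.2.1 hT
    rw [forall_unit_iff hq0 (p := fun s => ψ s q.1.1 ∉ A₁)] at hq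
    rw [forall_unit_iff hq0 (p := fun s => ψ s q.1.1 ∈ A \ A₁)]
    exact hA.mem_of_forall_notMem q.1.2 hq
  · intro p hp
    by_cases h1 : ∀ σ ∈ Icc (0 : ℝ) 1, ψ (σ * (p.2 * T)) p.1.1 ∈ A
    · right
      push Not at hp
      obtain ⟨σ, hσ, hσ1⟩ := hp
      have hσA : ψ (σ * (p.2 * T)) p.1.1 ∈ A₁ := by
        by_contra h2
        exact hσ1 ⟨h1 σ hσ, h2⟩
      have hp0 : 0 ≤ (p.2 : ℝ) * T := mul_nonneg p.2.2.1 hT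
      rw [forall_unit_iff hp0 (p := fun s => ψ s p.1.1 ∈ A)] at h1
      have hs := mul_nonneg hσ.1 hp0
      have := hA.pos_inv _ hσA (p.2 * T - σ * (p.2 * T))
        (by nlinarith [hσ.2]) fun r hr => by
          rw [← ψ.map_add]
          exact h1 _ ⟨by linarith [hr.1], by linarith [hr.2]⟩
      rwa [← ψ.map_add, sub_add_cancel] at this
    · left
      push Not at h1
      obtain ⟨σ, hσ, hσA⟩ := h1
      filter_upwards [(hc σ).continuousAt.eventually
        (hA.isClosed.isOpen_compl.mem_nhds hσA)] with q hq hqd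
      exact hq (hqd σ hσ).1

theorem transfer_transfer_toCollapse (hA : FlowPair ψ A A₁) (hB : FlowPair ψ B B₁) (hT : 0 ≤ T)
    (hAB : Dominates ψ T (A \ A₁) (B \ B₁)) (hBA : Dominates ψ T (B \ B₁) (A \ A₁)) {x : Z}
    (hx : x ∈ A) :
    transfer hB hA hT hBA hAB (transfer hA hB hT hAB hBA (toCollapse A A₁ x)) =
      pushFun ψ A A₁ (6 * T) x := by
  rw [transfer_toCollapse hA hB hT hAB hBA hx]
  have hE : (∀ σ ∈ Icc (0 : ℝ) 1, ψ (σ * (6 * T)) x ∈ A \ A₁) ↔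
      ∀ s ∈ Icc 0 (6 * T), ψ s x ∈ A \ A₁ :=
    forall_unit_iff (by linarith) (p := fun s => ψ s x ∈ A \ A₁)
  unfold pushFun
  rw [hE]
  by_cases h1 : x ∈ transferDomain ψ T A A₁ B B₁
  · rw [transferFun_of_mem h1, transfer_toCollapse hB hA hT hBA hAB
      (h1.2 (3 * T) ⟨by linarith, le_rfl⟩).1]
    by_cases h2 : ψ (3 * T) x ∈ transferDomain ψ T B B₁ A A₁
    · have h3 : ∀ s ∈ Icc (4 * T) (6 * T), ψ s x ∈ A \ A₁ := fun s hs => by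
        have := h2.2 (s - 3 * T) ⟨by linarith [hs.1], by linarith [hs.2]⟩
        rwa [← ψ.map_add, sub_add_cancel] at this
      have h4 : ∀ s ∈ Icc T (5 * T), ψ s x ∈ B \ B₁ := fun s hs => by
        rcases le_total s (3 * T) with h | h
        · exact h1.2 s ⟨hs.1, h⟩
        · have := h2.1 (s - 3 * T) ⟨by linarith, by linarith [hs.2]⟩
          rwa [← ψ.map_add, sub_add_cancel] at this
      have h5 := hBA.forall_mem h4
      rw [transferFun_of_mem h2, if_pos, ← ψ.map_add]
      · congr 2; ring
      · intro s hs
        rcases le_total s (2 * T) with h | h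
        · exact h1.1 s ⟨hs.1, h⟩
        · rcases le_total s (4 * T) with h' | h'
          · exact h5 s ⟨by linarith, by linarith⟩
          · exact h3 s ⟨h', hs.2⟩
    · rw [transferFun_of_notMem h2, if_neg]
      intro h3
      have h4 := hAB.forall_mem h3
      refine h2 ⟨fun s hs => ?_, fun s hs => ?_⟩
      · rw [← ψ.map_add]; exact h4 _ ⟨by linarith [hs.1], by linarith [hs.2]⟩
      · rw [← ψ.map_add]; exact h3 _ ⟨by linarith [hs.1], by linarith [hs.2]⟩
  · rw [transferFun_of_notMem h1, if_neg]
    · rfl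
    · intro h3
      have h4 := hAB.forall_mem h3
      exact h1 ⟨fun s hs => h3 s ⟨hs.1, by linarith [hs.2]⟩,
        fun s hs => h4 _ ⟨by linarith [hs.1], by linarith [hs.2]⟩⟩

theorem transfer_comp_homotopic (hA : FlowPair ψ A A₁) (hB : FlowPair ψ B B₁) (hT : 0 ≤ T)
    (hAB : Dominates ψ T (A \ A₁) (B \ B₁)) (hBA : Dominates ψ T (B \ B₁) (A \ A₁)) :
    ((transfer hB hA hT hBA hAB).comp (transfer hA hB hT hAB hBA)).HomotopicRel (.id _)
      {(collapse A A₁).pt} := by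
  refine ContinuousMap.HomotopicRel.symm ?_
  have h6 : 0 ≤ 6 * T := by linarith
  let E : C(A, C(unitInterval, (collapse A A₁).carrier)) :=
    ContinuousMap.curry ⟨_, continuous_pushFun hA h6⟩
  have hE : ∀ x : A, x.1 ∈ A₁ → E x = .const _ (collapse A A₁).pt := fun x hx => by
    ext r
    refine if_neg fun h => (h 0 ⟨le_rfl, zero_le_one⟩).2 ?_
    simpa using hx
  have hc := continuous_collapseDesc E _ hE E.continuous
  refine ⟨⟨⟨⟨fun q => collapseDesc E _ hE q.2 q.1, by fun_prop⟩, ?_, ?_⟩, ?_⟩⟩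
  · refine collapse_ind rfl fun x hx => ?_
    change collapseDesc E _ hE (toCollapse A A₁ x) 0 = _
    rw [collapseDesc_toCollapse _ _ _ hx]
    change pushFun ψ A A₁ ((0 : unitInterval) * (6 * T)) x = toCollapse A A₁ x
    rw [Set.Icc.coe_zero, zero_mul, pushFun_zero hx]
  · refine collapse_ind rfl fun x hx => ?_
    change collapseDesc E _ hE (toCollapse A A₁ x) 1 = _
    rw [collapseDesc_toCollapse _ _ _ hx, ContinuousMap.comp_apply,
      transfer_transfer_toCollapse hA hB hT hAB hBA hx]
    change pushFun ψ A A₁ ((1 : unitInterval) * (6 * T)) x = _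
    rw [Set.Icc.coe_one, one_mul]
  · rintro t _ rfl
    rfl

/-- The pointed homotopy type of a collapsed pair depends only on the long orbit segments in
`A \ A₁`. -/
theorem FlowPair.collapse_hEquiv (hA : FlowPair ψ A A₁) (hB : FlowPair ψ B B₁) (hT : 0 ≤ T)
    (hAB : Dominates ψ T (A \ A₁) (B \ B₁)) (hBA : Dominates ψ T (B \ B₁) (A \ A₁)) :
    (collapse A A₁).HEquiv (collapse B B₁) :=
  ⟨transfer hA hB hT hAB hBA, transfer hB hA hT hBA hAB, rfl, rfl,
    transfer_comp_homotopic hA hB hT hAB hBA, transfer_comp_homotopic hB hA hT hBA hAB⟩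

end FlowPair

/-! ### Additivity of the Conley index -/

section Index

open PointedSpace

variable {Z : Type u} [TopologicalSpace Z] {ψ : Flow ℝ Z} {S S₁ S₂ N N₁ P P₁ Q Q₁ V W : Set Z}

theorem isInvariant_Inv (ψ : Flow ℝ Z) (K : Set Z) : IsInvariant ψ (Inv ψ K) := by
  intro t x hx s
  rw [← ψ.map_add]
  exact hx _

theorem IsIsolatingNhd.isClosed [T2Space Z] {K : Set Z} (h : IsIsolatingNhd ψ K S) :
    IsClosed S := by
  rw [← h.inv_eq]
  have : Inv ψ K = ⋂ t, ψ t ⁻¹' K := by ext; simp [Inv]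
  rw [this]
  exact isClosed_iInter fun t => h.isCompact.isClosed.preimage (ψ.continuous_toFun t)

theorem IsIsolatingNhd.isInvariant {K : Set Z} (h : IsIsolatingNhd ψ K S) : IsInvariant ψ S :=
  h.inv_eq ▸ isInvariant_Inv ψ K

/-- Long orbit segments in a closed set have their midpoints near its maximal invariant subset. -/
theorem exists_dominates_of_Inv_subset [CompactSpace Z] {K U : Set Z} (hK : IsClosed K)
    (hU : IsOpen U) (h : Inv ψ K ⊆ U) : ∃ T, 0 ≤ T ∧ Dominates ψ T K U := by
  let F : ℕ → Set Z := fun n => {x | ∀ s ∈ Icc (-(n : ℝ)) n, ψ s x ∈ K}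
  have hF : ∀ n, IsClosed (F n) := fun n => by
    simp only [F, ofPred_forall]
    exact isClosed_biInter fun s _ => hK.preimage (ψ.continuous_toFun _)
  have hanti : Directed (· ⊇ ·) F := by
    refine directed_of_isDirected_le fun m n hmn x hx s hs => ?_
    have : (m : ℝ) ≤ n := by exact_mod_cast hmn
    exact hx s ⟨by linarith [hs.1], by linarith [hs.2]⟩
  have hemp : Uᶜ ∩ ⋂ n, F n = ∅ := by
    refine eq_empty_of_forall_notMem fun x ⟨hxU, hx⟩ => hxU (h fun t => ?_)
    obtain ⟨n, hn⟩ := exists_nat_ge |t|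
    exact mem_iInter.1 hx n t (abs_le.1 hn)
  obtain ⟨n, hn⟩ := hU.isClosed_compl.isCompact.elim_directed_family_closed F hF hemp
    hanti
  refine ⟨n, n.cast_nonneg, fun x hx => ?_⟩
  by_contra hxU
  exact eq_empty_iff_forall_notMem.1 hn x ⟨hxU, hx⟩

theorem IsIndexPair.exists_dominates [CompactSpace Z] (h : IsIndexPair ψ S N N₁) {U : Set Z}
    (hU : IsOpen U) (hSU : S ⊆ U) : ∃ T, 0 ≤ T ∧ Dominates ψ T (N \ N₁) U := by
  obtain ⟨T, hT, hd⟩ := exists_dominates_of_Inv_subset (ψ := ψ) isClosed_closure hU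
    (h.isolation.inv_eq.subset.trans hSU)
  exact ⟨T, hT, fun x hx => hd x fun s hs => subset_closure (hx s hs)⟩

theorem IsIndexPair.exists_isOpen [T2Space Z] (h : IsIndexPair ψ S N N₁) :
    ∃ U, IsOpen U ∧ S ⊆ U ∧ U ⊆ N \ N₁ := by
  refine ⟨interior (closure (N \ N₁)) ∩ N₁ᶜ,
    isOpen_interior.inter h.isCompact_exit.isClosed.isOpen_compl,
    fun x hx => ⟨h.isolation.subset_interior hx, disjoint_left.1 h.disjoint hx⟩,
    fun x hx => ⟨?_, hx.2⟩⟩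
  exact closure_minimal sdiff_subset h.isCompact.isClosed (interior_subset hx.1)

/-- The pair, in the invariant set `W`, obtained from an index pair by adding the part in the
invariant set `V` to the exit set. -/
theorem IsIndexPair.flowPair [T2Space Z] (h : IsIndexPair ψ S N N₁) (hV : IsClosed V)
    (hW : IsClosed W) (hVi : IsInvariant ψ V) (hWi : IsInvariant ψ W) :
    FlowPair ψ (N ∩ W) ((N₁ ∪ V) ∩ (N ∩ W)) := by
  have hNW := h.isCompact.isClosed.inter hW
  refine ⟨hNW, (h.isCompact_exit.isClosed.union hV).inter hNW, inter_subset_right, ?_, ?_⟩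
  · rintro x ⟨hx, hxN⟩ t ht hs
    refine ⟨?_, hs t ⟨ht, le_rfl⟩⟩
    rcases hx with hx | hx
    · left
      rcases ht.eq_or_lt with h0 | h0
      · rw [← h0]; simpa using hx
      · exact h.positively_invariant x hx t h0 (fun s hst => (hs s hst).1) t ⟨ht, le_rfl⟩
    · exact Or.inr (hVi t hx)
  · intro x hx t ht htx
    have htN : ψ t x ∉ N := fun hN => htx ⟨hN, hWi t hx.2⟩
    have h0 : 0 < t := ht.lt_of_ne fun h0 => htN (by rw [← h0]; simpa using hx.1)
    obtain ⟨s, hs, h1, h2⟩ := h.exits_through x hx.1 t h0 htN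
    exact ⟨s, hs, fun r hr => ⟨h1 r hr, hWi r hx.2⟩, Or.inl h2, h.subset h2, hWi s hx.2⟩

theorem mem_diff_exit_iff {Y : Type*} {N N₁ V W : Set Y} {x : Y} :
    x ∈ (N ∩ W) \ ((N₁ ∪ V) ∩ (N ∩ W)) ↔ x ∈ N \ N₁ ∧ x ∈ W ∧ x ∉ V := by
  simp only [Set.mem_sdiff, mem_inter_iff, mem_union]
  tauto

/-- An index pair of `S` can be localized near `S` without changing the homotopy type of the
collapsed pair. -/
theorem IsIndexPair.exists_localized [CompactSpace Z] [T2Space Z] (h : IsIndexPair ψ S P P₁)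
    (hV : IsClosed V) (hW : IsClosed W) (hVi : IsInvariant ψ V) (hWi : IsInvariant ψ W)
    {U : Set Z} (hU : IsOpen U) (hSU : S ⊆ U) :
    ∃ A A₁ O, FlowPair ψ A A₁ ∧ A ⊆ closure U ∧ A \ A₁ ⊆ (P ∩ W) \ ((P₁ ∪ V) ∩ (P ∩ W)) ∧
      IsOpen O ∧ S ⊆ O ∧ O ∩ (W \ V) ⊆ A \ A₁ ∧
      (collapse A A₁).HEquiv (collapse (P ∩ W) ((P₁ ∪ V) ∩ (P ∩ W))) := by
  obtain ⟨T, hT, hd⟩ := h.exists_dominates hU hSU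
  obtain ⟨U', hU', hSU', hU'P⟩ := h.exists_isOpen
  have hP := h.flowPair hV hW hVi hWi
  obtain ⟨A, A₁, hA, hAC, hAP, hPA⟩ := hP.exists_localized hT (isClosed_closure (s := U))
    fun x hx => subset_closure (hd x fun s hs => (mem_diff_exit_iff.1 (hx s hs)).1)
  refine ⟨A, A₁, {x | ∀ s ∈ Icc (-T) T, ψ s x ∈ U'}, hA, hAC, hAP,
    isOpen_forall_mem_Icc ψ hU' _ _, fun x hx s _ => hSU' (h.isolation.isInvariant s hx), ?_,
    hA.collapse_hEquiv hP hT (.of_subset hAP hT) hPA⟩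
  rintro x ⟨hx, hxW, hxV⟩
  refine hPA x fun s hs => mem_diff_exit_iff.2 ⟨hU'P (hx s hs), hWi s hxW, fun hsV => hxV ?_⟩
  have := hVi (-s) hsV
  rwa [← ψ.map_add, neg_add_cancel, ψ.map_zero_apply] at this

/-- The collapsed pair of a disjoint union of two isolated invariant sets is the wedge of the
collapsed pairs of the two sets, whatever index pairs are used. -/
theorem IsIndexPair.collapse_hEquiv_wedge [CompactSpace Z] [T2Space Z]
    (hN : IsIndexPair ψ (S₁ ∪ S₂) N N₁) (hP : IsIndexPair ψ S₁ P P₁) (hQ : IsIndexPair ψ S₂ Q Q₁)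
    (hS : Disjoint S₁ S₂) (hV : IsClosed V) (hW : IsClosed W) (hVi : IsInvariant ψ V)
    (hWi : IsInvariant ψ W) :
    (collapse (N ∩ W) ((N₁ ∪ V) ∩ (N ∩ W))).HEquiv
      ((collapse (P ∩ W) ((P₁ ∪ V) ∩ (P ∩ W))).wedge
        (collapse (Q ∩ W) ((Q₁ ∪ V) ∩ (Q ∩ W)))) := by
  obtain ⟨U, hU, hSU, hUS⟩ := normal_exists_closure_subset hP.isolation.isClosed
    hQ.isolation.isClosed.isOpen_compl (subset_compl_iff_disjoint_right.2 hS)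
  obtain ⟨U', hU', hSU', hUU'⟩ := normal_exists_closure_subset hQ.isolation.isClosed
    (isClosed_closure (s := U)).isOpen_compl (subset_compl_comm.1 hUS)
  obtain ⟨A, A₁, O, hA, hAU, hAP, hO, hSO, hOA, eA⟩ := hP.exists_localized hV hW hVi hWi hU hSU
  obtain ⟨B, B₁, O', hB, hBU, hBQ, hO', hSO', hOB, eB⟩ :=
    hQ.exists_localized hV hW hVi hWi hU' hSU'
  have hAB : Disjoint A B :=
    (subset_compl_iff_disjoint_right.1 (subset_compl_comm.1 hUU')).mono hAU hBU
  have hdiff : (A ∪ B) \ (A₁ ∪ B₁) = A \ A₁ ∪ B \ B₁ := by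
    ext x
    have h1 : x ∈ A → x ∉ B := fun h => disjoint_left.1 hAB h
    have h2 : x ∈ A₁ → x ∈ A := fun h => hA.subset h
    have h3 : x ∈ B₁ → x ∈ B := fun h => hB.subset h
    simp only [Set.mem_sdiff, mem_union]
    tauto
  obtain ⟨T₀, hT₀, hd₀⟩ := hN.exists_dominates (hO.union hO') (union_subset_union hSO hSO')
  obtain ⟨U₀, hU₀, hSU₀, hUN⟩ := hN.exists_isOpen
  obtain ⟨T₁, hT₁, hd₁⟩ := hP.exists_dominates hU₀ (subset_union_left.trans hSU₀)
  obtain ⟨T₂, hT₂, hd₂⟩ := hQ.exists_dominates hU₀ (subset_union_right.trans hSU₀)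
  set T := max T₀ (max T₁ T₂)
  have hT : 0 ≤ T := hT₀.trans (le_max_left _ _)
  have e := (hN.flowPair hV hW hVi hWi).collapse_hEquiv (hA.union hB hAB) hT ?_ ?_
  · exact e.trans ((collapse_union_hEquiv hA.isClosed hB.isClosed hAB hA.subset hB.subset).trans
      (eA.wedge eB))
  · intro x hx
    rw [hdiff]
    have hx0 := mem_diff_exit_iff.1 (hx 0 ⟨by linarith, hT⟩)
    rw [ψ.map_zero_apply] at hx0
    rcases (hd₀.mono (le_max_left _ _)) x fun s hs => (mem_diff_exit_iff.1 (hx s hs)).1 with h | h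
    · exact Or.inl (hOA ⟨h, hx0.2⟩)
    · exact Or.inr (hOB ⟨h, hx0.2⟩)
  · intro x hx
    rw [hdiff] at hx
    have h0 : ψ 0 x = x := ψ.map_zero_apply x
    have hI : (0 : ℝ) ∈ Icc (-T) T := ⟨by linarith, hT⟩
    rcases orbit_segment_subset_or ψ hA.isClosed hB.isClosed hAB
      fun s hs => (hx s hs).imp And.left And.left with h | h
    · have hs : ∀ s ∈ Icc (-T) T, ψ s x ∈ (P ∩ W) \ ((P₁ ∪ V) ∩ (P ∩ W)) := fun s hs =>
        hAP ((hx s hs).resolve_right fun hn => disjoint_left.1 hAB (h s hs) hn.1)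
      refine mem_diff_exit_iff.2 ⟨hUN ?_, h0 ▸ (mem_diff_exit_iff.1 (hs 0 hI)).2⟩
      exact hd₁.mono ((le_max_left _ _).trans (le_max_right _ _)) x fun s h' =>
        (mem_diff_exit_iff.1 (hs s h')).1
    · have hs : ∀ s ∈ Icc (-T) T, ψ s x ∈ (Q ∩ W) \ ((Q₁ ∪ V) ∩ (Q ∩ W)) := fun s hs =>
        hBQ ((hx s hs).resolve_left fun hn => disjoint_left.1 hAB hn.1 (h s hs))
      refine mem_diff_exit_iff.2 ⟨hUN ?_, h0 ▸ (mem_diff_exit_iff.1 (hs 0 hI)).2⟩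
      exact hd₂.mono ((le_max_right _ _).trans (le_max_right _ _)) x fun s h' =>
        (mem_diff_exit_iff.1 (hs s h')).1

/-- The Conley index, in a space with invariant boundary `E`, of the disjoint union of two isolated
invariant sets is the wedge of their indices. -/
theorem IsConleyIndex.hEquiv_wedge [CompactSpace Z] [T2Space Z] {E : Set Z} (hE : IsClosed E)
    (hEi : IsInvariant ψ E) (hS : Disjoint S₁ S₂) {h h₁ h₂ : IndexTriple.{u}}
    (hh : IsConleyIndex ψ E (S₁ ∪ S₂) h) (hh₁ : IsConleyIndex ψ E S₁ h₁)
    (hh₂ : IsConleyIndex ψ E S₂ h₂) : h.HEquiv (h₁.wedge h₂) := by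
  obtain ⟨N, N₁, hN, eN, eN', eN''⟩ := hh
  obtain ⟨P, P₁, hP, eP, eP', eP''⟩ := hh₁
  obtain ⟨Q, Q₁, hQ, eQ, eQ', eQ''⟩ := hh₂
  have hui : IsInvariant ψ univ := fun t x _ => mem_univ _
  have hei : IsInvariant ψ (∅ : Set Z) := fun t x hx => hx.elim
  -- the three components are the cases `(V, W) = (∅, univ)`, `(E, univ)` and `(∅, E)`
  have c1 : ∀ {M M₁ : Set Z}, M₁ ⊆ M → collapse M M₁ =
      collapse (M ∩ univ) ((M₁ ∪ ∅) ∩ (M ∩ univ)) := fun {M M₁} hM => by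
    rw [inter_univ, union_empty, inter_eq_left.2 hM]
  have c2 : ∀ {M M₁ : Set Z}, M₁ ⊆ M → collapse M (M₁ ∪ (M ∩ E)) =
      collapse (M ∩ univ) ((M₁ ∪ E) ∩ (M ∩ univ)) := fun {M M₁} hM => by
    rw [inter_univ, union_inter_distrib_right, inter_eq_left.2 hM, inter_comm E]
  have c3 : ∀ {M M₁ : Set Z}, M₁ ⊆ M → collapse (M ∩ E) (M₁ ∩ E) =
      collapse (M ∩ E) ((M₁ ∪ ∅) ∩ (M ∩ E)) := fun {M M₁} hM => by
    rw [union_empty, ← inter_assoc, inter_eq_left.2 hM]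
  simp only [indexTriple] at eN eN' eN'' eP eP' eP'' eQ eQ' eQ''
  rw [c1 hN.subset] at eN
  rw [c1 hP.subset] at eP
  rw [c1 hQ.subset] at eQ
  rw [c2 hN.subset] at eN'
  rw [c2 hP.subset] at eP'
  rw [c2 hQ.subset] at eQ'
  rw [c3 hN.subset] at eN''
  rw [c3 hP.subset] at eP''
  rw [c3 hQ.subset] at eQ''
  refine ⟨eN.trans (HEquiv.trans ?_ (eP.wedge eQ).symm),
    eN'.trans (HEquiv.trans ?_ (eP'.wedge eQ').symm),
    eN''.trans (HEquiv.trans ?_ (eP''.wedge eQ'').symm)⟩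
  · exact hN.collapse_hEquiv_wedge hP hQ hS isClosed_empty isClosed_univ hei hui
  · exact hN.collapse_hEquiv_wedge hP hQ hS hE isClosed_univ hEi hui
  · exact hN.collapse_hEquiv_wedge hP hQ hS isClosed_empty hE hei hEi

end Index

/-! ### Attractor-repeller decompositions -/

section AttractorRepeller

variable {Z : Type u} [TopologicalSpace Z] {ψ : Flow ℝ Z} {I A R : Set Z}

theorem frequently_mem_of_mem_omegaLimit {f : Filter ℝ} {x y : Z} {U : Set Z} (hU : IsOpen U)
    (hy : y ∈ omegaLimit f ψ {x}) (hyU : y ∈ U) : ∃ᶠ t in f, ψ t x ∈ U :=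
  mapClusterPt_iff_frequently.1 ((mem_omegaLimit_singleton_iff_mapClusterPt _ _ _ _).1 hy) U
    (hU.mem_nhds hyU)

theorem IsAttractorRepeller.omegaLim_subset (h : IsAttractorRepeller ψ I A R)
    (hI : IsInvariant ψ I) {x : Z} (hx : x ∈ I) (hxA : (omegaLim ψ x ∩ A).Nonempty) :
    omegaLim ψ x ⊆ A := by
  obtain ⟨U, hU, hAU, hω⟩ := h.attractor
  obtain ⟨y, hy, hyA⟩ := hxA
  obtain ⟨t, ht⟩ := (frequently_mem_of_mem_omegaLimit hU hy (hAU hyA)).exists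
  have hshift : ∀ t : ℝ, Tendsto (· + t) atTop atTop := fun t =>
    tendsto_atTop_add_const_right _ t tendsto_id
  have e := ψ.omegaLimit_image_eq (s := {x}) atTop hshift t
  rw [image_singleton] at e
  rw [← hω]
  change omegaLimit atTop ψ {x} ⊆ _
  rw [← e]
  exact omegaLimit_mono_right _ _ (singleton_subset_iff.2 ⟨ht, hI t hx⟩)

/-- Otherwise the backward orbit returns to the neighbourhood that `A` attracts at arbitrarily
negative times, which puts the point itself into the limit set `A`. -/
theorem IsAttractorRepeller.alphaLim_subset (h : IsAttractorRepeller ψ I A R) (hIc : IsClosed I)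
    (hI : IsInvariant ψ I) {x : Z} (hx : x ∈ I) (hxA : x ∉ A) : alphaLim ψ x ⊆ R := by
  intro y hy
  have hyI : y ∈ I := by
    have := omegaLimit_subset_closure_image2 (f := atBot) (ϕ := ψ) (s := {x}) univ_mem hy
    refine (hIc.closure_subset_iff.2 ?_) this
    rintro _ ⟨t, -, _, rfl, rfl⟩
    exact hI t hx
  rw [h.repeller]
  refine ⟨hyI, ?_⟩
  by_contra hne
  obtain ⟨z, hz, hzA⟩ := nonempty_iff_ne_empty.2 hne
  obtain ⟨U, hU, hAU, hω⟩ := h.attractor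
  obtain ⟨t, ht⟩ := (frequently_mem_of_mem_omegaLimit hU hz (hAU hzA)).exists
  have hfr := frequently_mem_of_mem_omegaLimit (hU.preimage (ψ.continuous_toFun t)) hy ht
  refine hxA ?_
  rw [← hω, omegaLimit_def]
  refine mem_iInter₂.2 fun u hu => subset_closure ?_
  obtain ⟨a, ha⟩ := mem_atTop_sets.1 hu
  obtain ⟨s, hs, hsU⟩ := (hfr.and_eventually (eventually_le_atBot (-a - t))).exists
  refine ⟨-(t + s), ha _ (by linarith), ψ (t + s) x, ⟨?_, hI _ hx⟩, ?_⟩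
  · rw [ψ.map_add]; exact hs
  · rw [← ψ.map_add, neg_add_cancel, ψ.map_zero_apply]

end AttractorRepeller

/-! ### Exit and entrance times -/

section Times

variable {Y : Type u} [TopologicalSpace Y] {φ : Flow ℝ Y} {B : Set Y} {x : Y} {c t : ℝ}

theorem exists_notMem_of_mem_exitSet (hc : φ c x ∈ exitSet φ B) (hct : c < t) :
    ∃ s, c < s ∧ s < t ∧ φ s x ∉ B := by
  obtain ⟨τ, h0, h1, h2⟩ := hc.2 (t - c) (by linarith)
  rw [← φ.map_add] at h2
  exact ⟨τ + c, by linarith, by linarith, h2⟩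

theorem exists_notMem_of_mem_entranceSet (hc : φ c x ∈ entranceSet φ B) (hct : t < c) :
    ∃ s, t < s ∧ s < c ∧ φ s x ∉ B := by
  obtain ⟨τ, h0, h1, h2⟩ := hc.2 (c - t) (by linarith)
  rw [← φ.map_add] at h2
  exact ⟨-τ + c, by linarith, by linarith, h2⟩

theorem exitTime_eq (h0 : 0 ≤ c) (hB : ∀ s ∈ Icc 0 c, φ s x ∈ B) (hc : φ c x ∈ exitSet φ B) :
    exitTime φ B x = c := by
  refine IsGreatest.csSup_eq ⟨⟨h0, hB⟩, fun t ht => ?_⟩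
  by_contra hlt
  obtain ⟨s, h1, h2, h3⟩ := exists_notMem_of_mem_exitSet hc (not_le.1 hlt)
  exact h3 (ht.2 s ⟨h0.trans h1.le, h2.le⟩)

theorem entranceTime_eq (h0 : c ≤ 0) (hB : ∀ s ∈ Icc c 0, φ s x ∈ B)
    (hc : φ c x ∈ entranceSet φ B) : entranceTime φ B x = c := by
  refine IsLeast.csInf_eq ⟨⟨h0, hB⟩, fun t ht => ?_⟩
  by_contra hlt
  obtain ⟨s, h1, h2, h3⟩ := exists_notMem_of_mem_entranceSet hc (not_le.1 hlt)
  exact h3 (ht.2 s ⟨h1.le, h2.le.trans h0⟩)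

theorem exitTime_nonneg : 0 ≤ exitTime φ B x := Real.sSup_nonneg fun _ h => h.1

theorem entranceTime_nonpos : entranceTime φ B x ≤ 0 := Real.sInf_nonpos fun _ h => h.1

theorem mem_of_le_exitTime (hx : x ∈ B) (he : φ (exitTime φ B x) x ∈ B) :
    ∀ s ∈ Icc 0 (exitTime φ B x), φ s x ∈ B := by
  intro s hs
  rcases hs.2.eq_or_lt with h | h
  · rwa [h]
  · have h0 : {t | 0 ≤ t ∧ ∀ s ∈ Icc 0 t, φ s x ∈ B}.Nonempty :=
      ⟨0, le_rfl, fun r hr => by rw [le_antisymm hr.2 hr.1]; simpa using hx⟩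
    obtain ⟨a, ha, hsa⟩ := exists_lt_of_lt_csSup h0 h
    exact ha.2 s ⟨hs.1, hsa.le⟩

theorem mem_of_entranceTime_le (hx : x ∈ B) (he : φ (entranceTime φ B x) x ∈ B) :
    ∀ s ∈ Icc (entranceTime φ B x) 0, φ s x ∈ B := by
  intro s hs
  rcases hs.1.eq_or_lt with h | h
  · rwa [← h]
  · have h0 : {t | t ≤ 0 ∧ ∀ s ∈ Icc t 0, φ s x ∈ B}.Nonempty :=
      ⟨0, le_rfl, fun r hr => by rw [le_antisymm hr.2 hr.1]; simpa using hx⟩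
    obtain ⟨a, ha, hsa⟩ := exists_lt_of_csInf_lt h0 h
    exact ha.2 s ⟨hsa.le, hs.2⟩

end Times

/-! ### The extended phase space -/

/-- The level `1 - exp (-d)` of the collars reached at time `d ≥ 0` after leaving `B`; negative
times are sent to the level `0`. -/
def height (d : ℝ) : unitInterval :=
  ⟨1 - Real.exp (-max d 0), by
    have h1 := Real.exp_le_one_iff.2 (neg_nonpos.2 (le_max_right d 0))
    exact ⟨by linarith, by linarith [Real.exp_pos (-max d 0)]⟩⟩

theorem coe_height {d : ℝ} (hd : 0 ≤ d) : (height d : ℝ) = 1 - Real.exp (-d) := by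
  simp [height, max_eq_left hd]

theorem continuous_height : Continuous height := by
  unfold height
  fun_prop

theorem height_zero : height 0 = 0 := Subtype.ext (by simp [height])

theorem height_ne_one (d : ℝ) : height d ≠ 1 := fun h => by
  have := congrArg Subtype.val h
  simp [height] at this

theorem log_one_sub_height {d : ℝ} (hd : 0 ≤ d) : Real.log (1 - height d) = -d := by
  rw [coe_height hd]
  simp

theorem exists_eq_height {s : unitInterval} (hs : s ≠ 1) : ∃ d, 0 ≤ d ∧ s = height d := by
  have h1 : (s : ℝ) < 1 := lt_of_le_of_ne s.2.2 fun h => hs (Subtype.ext h)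
  have hd : 0 ≤ -Real.log (1 - s) :=
    neg_nonneg.2 (Real.log_nonpos (by linarith) (by linarith [s.2.1]))
  refine ⟨_, hd, Subtype.ext ?_⟩
  rw [coe_height hd, neg_neg, Real.exp_log (by linarith)]
  ring

namespace ErsatzData

variable {Y : Type u} [TopologicalSpace Y] {φ : Flow ℝ Y} (D : ErsatzData φ)

theorem inExit_zero (y : ↥(exitSet φ D.B)) : D.inExit 0 y = D.inB ⟨y.1, y.2.1⟩ :=
  Quot.sound (Glue.exit _ _ rfl (by simp [D.retrOut.r_zero]))

theorem inEntrance_zero (y : ↥(entranceSet φ D.B)) : D.inEntrance 0 y = D.inB ⟨y.1, y.2.1⟩ :=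
  Quot.sound (Glue.entrance _ _ rfl (by simp [D.retrIn.r_zero]))

theorem ext_cases (p : D.Ext) :
    (∃ x, p = D.inB x) ∨ (∃ s y, p = D.inExit s y) ∨ ∃ s y, p = D.inEntrance s y := by
  obtain ⟨q, rfl⟩ := Quot.exists_rep p
  rcases q with x | ⟨⟨s, z⟩, y, h⟩ | ⟨⟨s, z⟩, y, h⟩
  · exact Or.inl ⟨x, rfl⟩
  · obtain rfl : (D.retrIn.r (s, y)).1 = z := h
    exact Or.inr (Or.inr ⟨s, y, rfl⟩)
  · obtain rfl : (D.retrOut.r (s, y)).1 = z := h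
    exact Or.inr (Or.inl ⟨s, y, rfl⟩)

theorem continuous_inB : Continuous D.inB := continuous_quot_mk.comp continuous_inl

theorem continuous_inExit : Continuous fun q : unitInterval × ↥(exitSet φ D.B) =>
    D.inExit q.1 q.2 := by
  refine continuous_quot_mk.comp (continuous_inr.comp (continuous_inr.comp ?_))
  exact Continuous.subtype_mk
    (continuous_fst.prodMk (continuous_subtype_val.comp D.retrOut.r.continuous)) _

theorem continuous_inEntrance : Continuous fun q : unitInterval × ↥(entranceSet φ D.B) =>
    D.inEntrance q.1 q.2 := by
  refine continuous_quot_mk.comp (continuous_inr.comp (continuous_inl.comp ?_))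
  exact Continuous.subtype_mk
    (continuous_fst.prodMk (continuous_subtype_val.comp D.retrIn.r.continuous)) _

instance : CompactSpace ↥D.B := isCompact_iff_compactSpace.1 D.block.isCompact

instance : CompactSpace ↥(exitSet φ D.B) := isCompact_iff_compactSpace.1
  (D.block.isCompact.of_isClosed_subset D.block.isClosed_exit fun _ h => h.1)

instance : CompactSpace ↥(entranceSet φ D.B) := isCompact_iff_compactSpace.1
  (D.block.isCompact.of_isClosed_subset D.block.isClosed_entrance fun _ h => h.1)

instance : CompactSpace D.Ext := by
  refine ⟨?_⟩
  have : (univ : Set D.Ext) = range D.inB ∪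
      (range (fun q : unitInterval × ↥(exitSet φ D.B) => D.inExit q.1 q.2) ∪
        range (fun q : unitInterval × ↥(entranceSet φ D.B) => D.inEntrance q.1 q.2)) := by
    refine (eq_univ_of_forall fun p => ?_).symm
    rcases D.ext_cases p with ⟨x, rfl⟩ | ⟨s, y, rfl⟩ | ⟨s, y, rfl⟩
    · exact Or.inl ⟨x, rfl⟩
    · exact Or.inr (Or.inl ⟨(s, y), rfl⟩)
    · exact Or.inr (Or.inr ⟨(s, y), rfl⟩)
  rw [this]
  exact (isCompact_range D.continuous_inB).union
    ((isCompact_range D.continuous_inExit).union (isCompact_range D.continuous_inEntrance))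

/-- The embedding of the extended phase space into `Y × ℝ` that puts `B` at height `0`, the collar
`β⁺` above it and the collar `β⁻` below it. -/
def embed : D.Ext → Y × ℝ :=
  Quot.lift (Sum.elim (fun x => (x.1, 0))
    (Sum.elim (fun q => (q.1.2, (q.1.1 : ℝ))) fun q => (q.1.2, -(q.1.1 : ℝ)))) (by
    rintro _ _ (⟨q, ξ, h0, h⟩ | ⟨q, ξ, h0, h⟩) <;> simp [h0, h])

theorem continuous_embed : Continuous D.embed := by
  refine continuous_quot_lift _ ?_
  refine Continuous.sumElim (by fun_prop) (Continuous.sumElim ?_ ?_) <;> fun_prop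

theorem embed_inB (x : ↥D.B) : D.embed (D.inB x) = (x.1, 0) := rfl

theorem embed_inExit (s : unitInterval) (y : ↥(exitSet φ D.B)) :
    D.embed (D.inExit s y) = ((D.retrOut.r (s, y)).1, -(s : ℝ)) := rfl

theorem embed_inEntrance (s : unitInterval) (y : ↥(entranceSet φ D.B)) :
    D.embed (D.inEntrance s y) = ((D.retrIn.r (s, y)).1, (s : ℝ)) := rfl

theorem inExit_congr {s s' : unitInterval} {y y' : ↥(exitSet φ D.B)} (hs : s = s')
    (h : (D.retrOut.r (s, y)).1 = (D.retrOut.r (s', y')).1) : D.inExit s y = D.inExit s' y' := by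
  subst hs
  exact congrArg (fun q => Quot.mk _ (Sum.inr (Sum.inr q))) (Subtype.ext (Prod.ext rfl h))

theorem inExit_ext {s s' : unitInterval} {y y' : ↥(exitSet φ D.B)} (hs : (s : ℝ) = s')
    (hy : y.1 = y'.1) : D.inExit s y = D.inExit s' y' := by
  rw [Subtype.ext hs, Subtype.ext hy]

theorem inEntrance_congr {s s' : unitInterval} {y y' : ↥(entranceSet φ D.B)} (hs : s = s')
    (h : (D.retrIn.r (s, y)).1 = (D.retrIn.r (s', y')).1) :
    D.inEntrance s y = D.inEntrance s' y' := by
  subst hs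
  exact congrArg (fun q => Quot.mk _ (Sum.inr (Sum.inl q))) (Subtype.ext (Prod.ext rfl h))

theorem inEntrance_ext {s s' : unitInterval} {y y' : ↥(entranceSet φ D.B)} (hs : (s : ℝ) = s')
    (hy : y.1 = y'.1) : D.inEntrance s y = D.inEntrance s' y' := by
  rw [Subtype.ext hs, Subtype.ext hy]

theorem eq_inB_of_embed {p : D.Ext} (h : (D.embed p).2 = 0) :
    ∃ x : ↥D.B, p = D.inB x ∧ x.1 = (D.embed p).1 := by
  rcases D.ext_cases p with ⟨x, rfl⟩ | ⟨s, y, rfl⟩ | ⟨s, y, rfl⟩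
  · exact ⟨x, rfl, rfl⟩
  · rw [embed_inExit] at h
    obtain rfl : s = 0 := Subtype.ext (neg_eq_zero.1 h)
    exact ⟨_, D.inExit_zero y, by simp [embed_inExit, D.retrOut.r_zero]⟩
  · rw [embed_inEntrance] at h
    obtain rfl : s = 0 := Subtype.ext h
    exact ⟨_, D.inEntrance_zero y, by simp [embed_inEntrance, D.retrIn.r_zero]⟩

theorem embed_injective : Function.Injective D.embed := by
  intro p q hpq
  by_cases h : (D.embed p).2 = 0
  · obtain ⟨x, rfl, hx⟩ := D.eq_inB_of_embed h
    obtain ⟨y, rfl, hy⟩ := D.eq_inB_of_embed (hpq ▸ h)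
    congr 1
    exact Subtype.ext (hx.trans (hpq ▸ hy.symm))
  have h' : (D.embed q).2 ≠ 0 := hpq ▸ h
  rcases D.ext_cases p with ⟨x, rfl⟩ | ⟨s, x, rfl⟩ | ⟨s, x, rfl⟩
  · exact (h rfl).elim
  · rcases D.ext_cases q with ⟨y, rfl⟩ | ⟨s', y, rfl⟩ | ⟨s', y, rfl⟩
    · exact (h' rfl).elim
    · have := Prod.ext_iff.1 hpq
      exact D.inExit_congr (Subtype.ext (neg_injective this.2)) this.1
    · have := (Prod.ext_iff.1 hpq).2
      simp only [embed_inExit, embed_inEntrance] at this h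
      exact (h (by linarith [s.2.1, s'.2.1])).elim
  · rcases D.ext_cases q with ⟨y, rfl⟩ | ⟨s', y, rfl⟩ | ⟨s', y, rfl⟩
    · exact (h' rfl).elim
    · have := (Prod.ext_iff.1 hpq).2
      simp only [embed_inExit, embed_inEntrance] at this h
      exact (h (by linarith [s.2.1, s'.2.1])).elim
    · have := Prod.ext_iff.1 hpq
      exact D.inEntrance_congr (Subtype.ext this.2) this.1

instance [T2Space Y] : T2Space D.Ext :=
  T2Space.of_injective_continuous D.embed_injective D.continuous_embed

/-! ### The extended flow is a flow -/

/-- `p` is the point reached at time `t` from the point `x` of `B`: at some time `c` up to which the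
orbit of `x` stays in `B`, it is `p` itself with `t = c`, or it enters the collar that contains
`p`. The relation `p = D.flowB t x` without its case distinction on signs and exit times, which
makes it invariant under shifts along the orbit and visibly closed. -/
def IsAt (x : ↥D.B) (t : ℝ) (p : D.Ext) : Prop :=
  ∃ c, (∀ s ∈ uIcc 0 c, φ s x.1 ∈ D.B) ∧
    ((t = c ∧ ∃ y : ↥D.B, y.1 = φ c x.1 ∧ p = D.inB y) ∨
      (c ≤ t ∧ ∃ y : ↥(exitSet φ D.B), y.1 = φ c x.1 ∧ p = D.inExit (height (t - c)) y) ∨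
      (t ≤ c ∧ ∃ y : ↥(entranceSet φ D.B), y.1 = φ c x.1 ∧ p = D.inEntrance (height (c - t)) y))

variable {D}

theorem IsAt.shift {x y : ↥D.B} {a t : ℝ} {p : D.Ext} (h : D.IsAt y t p)
    (ha : ∀ s ∈ uIcc 0 a, φ s x.1 ∈ D.B) (hy : y.1 = φ a x.1) : D.IsAt x (a + t) p := by
  obtain ⟨c, hc, h⟩ := h
  have e : ∀ s, φ s y.1 = φ (s + a) x.1 := fun s => by rw [hy, φ.map_add]
  refine ⟨a + c, fun s hs => ?_, ?_⟩
  · rcases uIcc_subset_uIcc_union_uIcc (b := a) hs with h1 | h1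
    · exact ha s h1
    · have : s - a ∈ uIcc 0 c := by
        rcases mem_uIcc.1 h1 with h2 | h2
        · exact mem_uIcc.2 (Or.inl ⟨by linarith, by linarith⟩)
        · exact mem_uIcc.2 (Or.inr ⟨by linarith, by linarith⟩)
      have := hc _ this
      rwa [e, sub_add_cancel] at this
  · rw [add_comm a c, ← e]
    rcases h with ⟨rfl, h⟩ | ⟨hle, h⟩ | ⟨hle, h⟩
    · exact Or.inl ⟨add_comm _ _, h⟩
    · refine Or.inr (Or.inl ⟨by linarith, ?_⟩)
      rwa [show a + t - (c + a) = t - c by ring]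
    · refine Or.inr (Or.inr ⟨by linarith, ?_⟩)
      rwa [show c + a - (a + t) = c - t by ring]

theorem flowB_eq_inB {x y : ↥D.B} {c : ℝ} (hc : ∀ s ∈ uIcc 0 c, φ s x.1 ∈ D.B)
    (hy : y.1 = φ c x.1) : D.flowB c x = D.inB y := by
  unfold flowB
  split_ifs with h0 h1 h1
  · exact congrArg _ (Subtype.ext hy.symm)
  · exact (h1 fun s hs => hc s (by rwa [uIcc_of_le h0])).elim
  · exact congrArg _ (Subtype.ext hy.symm)
  · exact (h1 fun s hs => hc s (by rwa [uIcc_of_ge (not_le.1 h0).le])).elim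

theorem IsAt.eq_flowB {x : ↥D.B} {t : ℝ} {p : D.Ext} (h : D.IsAt x t p) : D.flowB t x = p := by
  obtain ⟨c, hc, ⟨rfl, y, hy, rfl⟩ | ⟨hle, y, hy, rfl⟩ | ⟨hle, y, hy, rfl⟩⟩ := h
  · exact flowB_eq_inB hc hy
  · rcases hle.eq_or_lt with rfl | hlt
    · rw [sub_self, height_zero, inExit_zero]
      exact flowB_eq_inB hc hy
    have hyc : φ c x.1 ∈ exitSet φ D.B := hy ▸ y.2
    -- an orbit that stays in `B` up to time `0` is not in the exit set before
    have h0 : 0 ≤ c := by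
      by_contra h0
      obtain ⟨s, h1, h2, h3⟩ := exists_notMem_of_mem_exitSet hyc (not_le.1 h0)
      exact h3 (hc s (mem_uIcc.2 (Or.inr ⟨h1.le, h2.le⟩)))
    have hT : exitTime φ D.B x.1 = c :=
      exitTime_eq h0 (fun s hs => hc s (by rwa [uIcc_of_le h0])) hyc
    unfold flowB
    rw [dif_pos (h0.trans hle), dif_neg]
    · refine D.inExit_ext ?_ (by simp only [hT, hy])
      rw [coe_height (sub_nonneg.2 hle)]
      simp [hT]
    · intro h
      obtain ⟨s, h1, h2, h3⟩ := exists_notMem_of_mem_exitSet hyc hlt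
      exact h3 (h s ⟨h0.trans h1.le, h2.le⟩)
  · rcases hle.eq_or_lt with rfl | hlt
    · rw [sub_self, height_zero, inEntrance_zero]
      exact flowB_eq_inB hc hy
    have hyc : φ c x.1 ∈ entranceSet φ D.B := hy ▸ y.2
    have h0 : c ≤ 0 := by
      by_contra h0
      obtain ⟨s, h1, h2, h3⟩ := exists_notMem_of_mem_entranceSet hyc (not_le.1 h0)
      exact h3 (hc s (mem_uIcc.2 (Or.inl ⟨h1.le, h2.le⟩)))
    have hT : entranceTime φ D.B x.1 = c :=
      entranceTime_eq h0 (fun s hs => hc s (by rwa [uIcc_of_ge h0])) hyc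
    unfold flowB
    rw [dif_neg (not_le.2 (hlt.trans_le h0)), dif_neg]
    · refine D.inEntrance_ext ?_ (by simp only [hT, hy])
      rw [coe_height (sub_nonneg.2 hle)]
      simp [hT]
    · intro h
      obtain ⟨s, h1, h2, h3⟩ := exists_notMem_of_mem_entranceSet hyc hlt
      exact h3 (h s ⟨h1.le, h2.le.trans h0⟩)

theorem isAt_of_forall_mem {x y : ↥D.B} {t : ℝ} (h : ∀ s ∈ uIcc 0 t, φ s x.1 ∈ D.B)
    (hy : y.1 = φ t x.1) : D.IsAt x t (D.inB y) :=
  ⟨t, h, Or.inl ⟨rfl, y, hy, rfl⟩⟩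

variable (D)

theorem isAt_flowB (x : ↥D.B) (t : ℝ) : D.IsAt x t (D.flowB t x) := by
  unfold flowB
  split_ifs with h0 h1 h1
  · exact isAt_of_forall_mem (by rwa [uIcc_of_le h0]) rfl
  · have hs := exitTime_spec D.block.isClosed x.2 h1
    refine ⟨exitTime φ D.B x.1, ?_, Or.inr (Or.inl ⟨hs.1, ⟨_, hs.2⟩, rfl, ?_⟩)⟩
    · rw [uIcc_of_le exitTime_nonneg]
      exact mem_of_le_exitTime x.2 hs.2.1
    · congr 1
      exact Subtype.ext (by rw [coe_height (sub_nonneg.2 hs.1)]; simp)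
  · exact isAt_of_forall_mem (by rwa [uIcc_of_ge (not_le.1 h0).le]) rfl
  · have hs := entranceTime_spec D.block.isClosed x.2 h1
    refine ⟨entranceTime φ D.B x.1, ?_, Or.inr (Or.inr ⟨hs.1, ⟨_, hs.2⟩, rfl, ?_⟩)⟩
    · rw [uIcc_of_ge entranceTime_nonpos]
      exact mem_of_entranceTime_le x.2 hs.2.1
    · congr 1
      exact Subtype.ext (by rw [coe_height (sub_nonneg.2 hs.1)]; simp)

theorem forall_mem_uIcc_zero (x : ↥D.B) : ∀ s ∈ uIcc 0 (0 : ℝ), φ s x.1 ∈ D.B := by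
  intro s hs
  rw [uIcc_self, mem_singleton_iff] at hs
  simp [hs]

theorem isAt_inB (x : ↥D.B) : D.IsAt x 0 (D.inB x) :=
  isAt_of_forall_mem (D.forall_mem_uIcc_zero x) (by simp)

theorem isAt_inExit {d : ℝ} (hd : 0 ≤ d) (y : ↥(exitSet φ D.B)) :
    D.IsAt ⟨y.1, y.2.1⟩ d (D.inExit (height d) y) :=
  ⟨0, D.forall_mem_uIcc_zero _, Or.inr (Or.inl ⟨hd, y, by simp, by simp⟩)⟩

theorem isAt_inEntrance {d : ℝ} (hd : 0 ≤ d) (y : ↥(entranceSet φ D.B)) :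
    D.IsAt ⟨y.1, y.2.1⟩ (-d) (D.inEntrance (height d) y) :=
  ⟨0, D.forall_mem_uIcc_zero _, Or.inr (Or.inr ⟨by linarith, y, by simp, by simp⟩)⟩

theorem extFlow_inExit_one (t : ℝ) (y : ↥(exitSet φ D.B)) :
    D.extFlow t (D.inExit 1 y) = D.inExit 1 y := if_pos rfl

theorem extFlow_inEntrance_one (t : ℝ) (y : ↥(entranceSet φ D.B)) :
    D.extFlow t (D.inEntrance 1 y) = D.inEntrance 1 y := if_pos rfl

theorem extFlow_inExit (t : ℝ) {s : unitInterval} (hs : s ≠ 1) (y : ↥(exitSet φ D.B)) :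
    D.extFlow t (D.inExit s y) = D.flowB (t - Real.log (1 - s)) ⟨y.1, y.2.1⟩ := by
  refine (if_neg hs).trans (congrArg _ (Subtype.ext ?_))
  have hq : ∃ x, (D.retrOut.r (s, x)).1 = (D.retrOut.r (s, y)).1 := ⟨y, rfl⟩
  change hq.choose.1 = y.1
  rw [D.retrOut.inj s (lt_of_le_of_ne unitInterval.le_one' hs) _ _ (Subtype.ext hq.choose_spec)]

theorem extFlow_inEntrance (t : ℝ) {s : unitInterval} (hs : s ≠ 1) (y : ↥(entranceSet φ D.B)) :
    D.extFlow t (D.inEntrance s y) = D.flowB (t + Real.log (1 - s)) ⟨y.1, y.2.1⟩ := by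
  refine (if_neg hs).trans (congrArg _ (Subtype.ext ?_))
  have hq : ∃ x, (D.retrIn.r (s, x)).1 = (D.retrIn.r (s, y)).1 := ⟨y, rfl⟩
  change hq.choose.1 = y.1
  rw [D.retrIn.inj s (lt_of_le_of_ne unitInterval.le_one' hs) _ _ (Subtype.ext hq.choose_spec)]

variable {D}

theorem IsAt.extFlow {x : ↥D.B} {a : ℝ} {p : D.Ext} (h : D.IsAt x a p) (t : ℝ) :
    D.IsAt x (a + t) (D.extFlow t p) := by
  obtain ⟨c, hc, ⟨rfl, y, hy, rfl⟩ | ⟨hle, y, hy, rfl⟩ | ⟨hle, y, hy, rfl⟩⟩ := h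
  · exact (D.isAt_flowB y t).shift hc hy
  · have hd := sub_nonneg.2 hle
    rw [D.extFlow_inExit t (height_ne_one _), log_one_sub_height hd]
    convert (D.isAt_flowB ⟨y.1, y.2.1⟩ (t - -(a - c))).shift hc hy using 1
    ring
  · have hd := sub_nonneg.2 hle
    rw [D.extFlow_inEntrance t (height_ne_one _), log_one_sub_height hd]
    convert (D.isAt_flowB ⟨y.1, y.2.1⟩ (t + -(c - a))).shift hc hy using 1
    ring

theorem IsAt.extFlow_eq {x : ↥D.B} {a t : ℝ} {p q : D.Ext} (h : D.IsAt x a p)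
    (h' : D.IsAt x (a + t) q) : D.extFlow t p = q :=
  (h.extFlow t).eq_flowB.symm.trans h'.eq_flowB

variable (D)

/-- A point of the extended phase space lies on the orbit of a point of `B` or is one of the rest
points at the ends of the collars. -/
theorem exists_isAt_or (p : D.Ext) :
    (∃ x a, D.IsAt x a p) ∨ (∃ y, p = D.inExit 1 y) ∨ ∃ y, p = D.inEntrance 1 y := by
  rcases D.ext_cases p with ⟨x, rfl⟩ | ⟨s, y, rfl⟩ | ⟨s, y, rfl⟩
  · exact Or.inl ⟨x, 0, D.isAt_inB x⟩
  · by_cases hs : s = 1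
    · exact Or.inr (Or.inl ⟨y, by rw [hs]⟩)
    · obtain ⟨d, hd, rfl⟩ := exists_eq_height hs
      exact Or.inl ⟨_, _, D.isAt_inExit hd y⟩
  · by_cases hs : s = 1
    · exact Or.inr (Or.inr ⟨y, by rw [hs]⟩)
    · obtain ⟨d, hd, rfl⟩ := exists_eq_height hs
      exact Or.inl ⟨_, _, D.isAt_inEntrance hd y⟩

theorem extFlow_zero (p : D.Ext) : D.extFlow 0 p = p := by
  rcases D.exists_isAt_or p with ⟨x, a, h⟩ | ⟨y, rfl⟩ | ⟨y, rfl⟩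
  · exact h.extFlow_eq (by rwa [add_zero])
  · exact D.extFlow_inExit_one _ _
  · exact D.extFlow_inEntrance_one _ _

theorem extFlow_add (s t : ℝ) (p : D.Ext) : D.extFlow (s + t) p = D.extFlow s (D.extFlow t p) := by
  rcases D.exists_isAt_or p with ⟨x, a, h⟩ | ⟨y, rfl⟩ | ⟨y, rfl⟩
  · refine h.extFlow_eq ?_
    convert (h.extFlow t).extFlow s using 1
    ring
  · simp only [extFlow_inExit_one]
  · simp only [extFlow_inEntrance_one]

theorem isClosed_and {X : Type*} [TopologicalSpace X] {p q : X → Prop} (hp : IsClosed {x | p x})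
    (hq : IsClosed {x | q x}) : IsClosed {x | p x ∧ q x} := hp.inter hq

theorem isClosed_segment {X : Type*} [TopologicalSpace X] {f : X → ℝ} {g : X → Y}
    (hf : Continuous f) (hg : Continuous g) :
    IsClosed {z : X | ∀ r : unitInterval, φ (r * f z) (g z) ∈ D.B} := by
  simp only [ofPred_forall]
  exact isClosed_iInter fun r => D.block.isClosed.preimage (φ.continuous (by fun_prop) hg)

theorem forall_unitInterval_mul_iff {c : ℝ} {p : ℝ → Prop} :
    (∀ r : unitInterval, p (r * c)) ↔ ∀ s ∈ uIcc 0 c, p s := by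
  constructor
  · intro h s hs
    rcases eq_or_ne c 0 with rfl | hc
    · rw [uIcc_self, mem_singleton_iff] at hs
      simpa [hs] using h 0
    · have hr : s / c ∈ unitInterval := by
        rcases mem_uIcc.1 hs with h1 | h1
        · exact ⟨div_nonneg h1.1 (h1.1.trans h1.2), div_le_one_of_le₀ h1.2 (h1.1.trans h1.2)⟩
        · exact ⟨div_nonneg_of_nonpos h1.2 (h1.1.trans h1.2),
            div_le_one_of_ge h1.1 (h1.1.trans h1.2)⟩
      have := h ⟨s / c, hr⟩
      simpa [div_mul_cancel₀ _ hc] using this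
  · intro h r
    refine h _ ?_
    rcases le_total 0 c with h1 | h1
    · exact mem_uIcc.2 (Or.inl ⟨mul_nonneg r.2.1 h1, mul_le_of_le_one_left h1 r.2.2⟩)
    · exact mem_uIcc.2 (Or.inr ⟨by nlinarith [r.2.2], mul_nonpos_of_nonneg_of_nonpos r.2.1 h1⟩)

variable {D} in
/-- The time `c` in the definition of `IsAt` can be taken between `0` and `t`. -/
theorem IsAt.exists_unitInterval {x : ↥D.B} {t : ℝ} {p : D.Ext} (h : D.IsAt x t p) :
    ∃ θ : unitInterval, (∀ r : unitInterval, φ (r * (θ * t)) x.1 ∈ D.B) ∧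
    ((t = θ * t ∧ ∃ y : ↥D.B, y.1 = φ (θ * t) x.1 ∧ p = D.inB y) ∨
      (θ * t ≤ t ∧ ∃ y : ↥(exitSet φ D.B), y.1 = φ (θ * t) x.1 ∧
        p = D.inExit (height (t - θ * t)) y) ∨
      (t ≤ θ * t ∧ ∃ y : ↥(entranceSet φ D.B), y.1 = φ (θ * t) x.1 ∧
        p = D.inEntrance (height (θ * t - t)) y)) := by
  obtain ⟨c, hc, h⟩ := h
  have hθ : ∃ θ : unitInterval, c = θ * t := by
    have key : (0 ≤ c ∧ c ≤ t) ∨ (t ≤ c ∧ c ≤ 0) ∨ t = c := by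
      rcases h with ⟨rfl, -⟩ | ⟨hle, y, hy, -⟩ | ⟨hle, y, hy, -⟩
      · exact Or.inr (Or.inr rfl)
      · refine Or.inl ⟨?_, hle⟩
        by_contra h0
        obtain ⟨s, h1, h2, h3⟩ := exists_notMem_of_mem_exitSet (hy ▸ y.2) (not_le.1 h0)
        exact h3 (hc s (mem_uIcc.2 (Or.inr ⟨h1.le, h2.le⟩)))
      · refine Or.inr (Or.inl ⟨hle, ?_⟩)
        by_contra h0
        obtain ⟨s, h1, h2, h3⟩ := exists_notMem_of_mem_entranceSet (hy ▸ y.2) (not_le.1 h0)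
        exact h3 (hc s (mem_uIcc.2 (Or.inl ⟨h1.le, h2.le⟩)))
    rcases eq_or_ne t c with rfl | htc
    · exact ⟨1, by simp⟩
    have hm : c ∈ uIcc 0 t := by
      rcases key with h1 | h1 | h1
      · exact mem_uIcc.2 (Or.inl h1)
      · exact mem_uIcc.2 (Or.inr h1)
      · exact (htc h1).elim
    refine (forall_unitInterval_mul_iff (p := fun s => ∃ θ : unitInterval, s = θ * t)).1
      (fun r => ⟨r, rfl⟩) c hm
  obtain ⟨θ, rfl⟩ := hθ
  exact ⟨θ, forall_unitInterval_mul_iff.2 hc, h⟩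

section Closed

variable [T2Space Y]

theorem isClosed_isAt : IsClosed {z : ↥D.B × ℝ × D.Ext | D.IsAt z.1 z.2.1 z.2.2} := by
  let P₀ : Set ((unitInterval × ↥D.B) × ↥D.B × ℝ × D.Ext) := {w |
    (∀ r : unitInterval, φ (r * (w.1.1 * w.2.2.1)) w.2.1.1 ∈ D.B) ∧ w.2.2.1 = w.1.1 * w.2.2.1 ∧
      w.1.2.1 = φ (w.1.1 * w.2.2.1) w.2.1.1 ∧ w.2.2.2 = D.inB w.1.2}
  let P₁ : Set ((unitInterval × ↥(exitSet φ D.B)) × ↥D.B × ℝ × D.Ext) := {w |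
    (∀ r : unitInterval, φ (r * (w.1.1 * w.2.2.1)) w.2.1.1 ∈ D.B) ∧ w.1.1 * w.2.2.1 ≤ w.2.2.1 ∧
      w.1.2.1 = φ (w.1.1 * w.2.2.1) w.2.1.1 ∧
      w.2.2.2 = D.inExit (height (w.2.2.1 - w.1.1 * w.2.2.1)) w.1.2}
  let P₂ : Set ((unitInterval × ↥(entranceSet φ D.B)) × ↥D.B × ℝ × D.Ext) := {w |
    (∀ r : unitInterval, φ (r * (w.1.1 * w.2.2.1)) w.2.1.1 ∈ D.B) ∧ w.2.2.1 ≤ w.1.1 * w.2.2.1 ∧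
      w.1.2.1 = φ (w.1.1 * w.2.2.1) w.2.1.1 ∧
      w.2.2.2 = D.inEntrance (height (w.1.1 * w.2.2.1 - w.2.2.1)) w.1.2}
  have c₀ : IsClosed P₀ := by
    refine isClosed_and (D.isClosed_segment (by fun_prop) (by fun_prop)) (isClosed_and
      (isClosed_eq (by fun_prop) (by fun_prop)) (isClosed_and (isClosed_eq (by fun_prop)
      (φ.continuous (by fun_prop) (by fun_prop))) (isClosed_eq (by fun_prop) ?_)))
    exact D.continuous_inB.comp (by fun_prop)
  have c₁ : IsClosed P₁ := by
    refine isClosed_and (D.isClosed_segment (by fun_prop) (by fun_prop)) (isClosed_and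
      (isClosed_le (by fun_prop) (by fun_prop)) (isClosed_and (isClosed_eq (by fun_prop)
      (φ.continuous (by fun_prop) (by fun_prop))) (isClosed_eq (by fun_prop) ?_)))
    exact D.continuous_inExit.comp
      ((continuous_height.comp (by fun_prop)).prodMk (by fun_prop))
  have c₂ : IsClosed P₂ := by
    refine isClosed_and (D.isClosed_segment (by fun_prop) (by fun_prop)) (isClosed_and
      (isClosed_le (by fun_prop) (by fun_prop)) (isClosed_and (isClosed_eq (by fun_prop)
      (φ.continuous (by fun_prop) (by fun_prop))) (isClosed_eq (by fun_prop) ?_)))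
    exact D.continuous_inEntrance.comp
      ((continuous_height.comp (by fun_prop)).prodMk (by fun_prop))
  have := (isClosedMap_snd_of_compactSpace _ c₀).union
    ((isClosedMap_snd_of_compactSpace _ c₁).union (isClosedMap_snd_of_compactSpace _ c₂))
  convert this using 1
  ext ⟨x, t, p⟩
  constructor
  · intro h
    obtain ⟨θ, hθ, ⟨h1, y, hy, hp⟩ | ⟨h1, y, hy, hp⟩ | ⟨h1, y, hy, hp⟩⟩ := h.exists_unitInterval
    · exact Or.inl ⟨((θ, y), x, t, p), ⟨hθ, h1, hy, hp⟩, rfl⟩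
    · exact Or.inr (Or.inl ⟨((θ, y), x, t, p), ⟨hθ, h1, hy, hp⟩, rfl⟩)
    · exact Or.inr (Or.inr ⟨((θ, y), x, t, p), ⟨hθ, h1, hy, hp⟩, rfl⟩)
  · rintro (⟨⟨⟨θ, y⟩, _⟩, ⟨hθ, h1, hy, hp⟩, rfl⟩ | ⟨⟨⟨θ, y⟩, _⟩, ⟨hθ, h1, hy, hp⟩, rfl⟩ |
      ⟨⟨⟨θ, y⟩, _⟩, ⟨hθ, h1, hy, hp⟩, rfl⟩)
    · exact ⟨_, forall_unitInterval_mul_iff.1 hθ, Or.inl ⟨h1, y, hy, hp⟩⟩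
    · exact ⟨_, forall_unitInterval_mul_iff.1 hθ, Or.inr (Or.inl ⟨h1, y, hy, hp⟩)⟩
    · exact ⟨_, forall_unitInterval_mul_iff.1 hθ, Or.inr (Or.inr ⟨h1, y, hy, hp⟩)⟩

/-- The graph of the extended flow is closed: it consists of the motions inside one of the two
collars, which have explicit levels, and of those between whose end points the orbit visits a point
of `B`. Each of the three kinds has parameters in a compact space. -/
theorem isClosed_graph_extFlow :
    IsClosed {z : (ℝ × D.Ext) × D.Ext | z.2 = D.extFlow z.1.1 z.1.2} := by
  let G₀ : Set ((unitInterval × ↥D.B) × (ℝ × D.Ext) × D.Ext) := {w |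
    D.IsAt w.1.2 (-(w.1.1 * w.2.1.1)) w.2.1.2 ∧
      D.IsAt w.1.2 (-(w.1.1 * w.2.1.1) + w.2.1.1) w.2.2}
  let G₁ : Set ((unitInterval × unitInterval × ↥(exitSet φ D.B)) × (ℝ × D.Ext) × D.Ext) := {w |
    1 - (w.1.2.1 : ℝ) = (1 - w.1.1) * Real.exp (-w.2.1.1) ∧
      w.2.1.2 = D.inExit w.1.1 w.1.2.2 ∧ w.2.2 = D.inExit w.1.2.1 w.1.2.2}
  let G₂ : Set ((unitInterval × unitInterval × ↥(entranceSet φ D.B)) × (ℝ × D.Ext) × D.Ext) := {w |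
    1 - (w.1.2.1 : ℝ) = (1 - w.1.1) * Real.exp w.2.1.1 ∧
      w.2.1.2 = D.inEntrance w.1.1 w.1.2.2 ∧ w.2.2 = D.inEntrance w.1.2.1 w.1.2.2}
  have c₀ : IsClosed G₀ := by
    refine IsClosed.inter ?_ ?_
    · exact D.isClosed_isAt.preimage (f := fun w : (unitInterval × ↥D.B) × (ℝ × D.Ext) × D.Ext =>
        (w.1.2, -(w.1.1 * w.2.1.1), w.2.1.2)) (by fun_prop)
    · exact D.isClosed_isAt.preimage (f := fun w : (unitInterval × ↥D.B) × (ℝ × D.Ext) × D.Ext =>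
        (w.1.2, -(w.1.1 * w.2.1.1) + w.2.1.1, w.2.2)) (by fun_prop)
  have c₁ : IsClosed G₁ := by
    refine isClosed_and (isClosed_eq (by fun_prop) (by fun_prop))
      (isClosed_and (isClosed_eq (by fun_prop) ?_) (isClosed_eq (by fun_prop) ?_))
    · exact D.continuous_inExit.comp (Continuous.prodMk (by fun_prop) (by fun_prop))
    · exact D.continuous_inExit.comp (continuous_snd.comp continuous_fst)
  have c₂ : IsClosed G₂ := by
    refine isClosed_and (isClosed_eq (by fun_prop) (by fun_prop))
      (isClosed_and (isClosed_eq (by fun_prop) ?_) (isClosed_eq (by fun_prop) ?_))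
    · exact D.continuous_inEntrance.comp (Continuous.prodMk (by fun_prop) (by fun_prop))
    · exact D.continuous_inEntrance.comp (continuous_snd.comp continuous_fst)
  have := (isClosedMap_snd_of_compactSpace _ c₀).union
    ((isClosedMap_snd_of_compactSpace _ c₁).union (isClosedMap_snd_of_compactSpace _ c₂))
  convert this using 1
  ext ⟨⟨t, p⟩, q⟩
  constructor
  · intro h
    obtain rfl : q = D.extFlow t p := h
    rcases D.ext_cases p with ⟨x, rfl⟩ | ⟨s, y, rfl⟩ | ⟨s, y, rfl⟩
    · refine Or.inl ⟨((0, x), (t, D.inB x), D.extFlow t (D.inB x)), ⟨?_, ?_⟩, rfl⟩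
      · simpa using D.isAt_inB x
      · simpa using (D.isAt_inB x).extFlow t
    · by_cases hs : s = 1
      · subst hs
        exact Or.inr (Or.inl ⟨((1, 1, y), (t, D.inExit 1 y), _),
          ⟨by simp, rfl, D.extFlow_inExit_one t y⟩, rfl⟩)
      obtain ⟨d, hd, rfl⟩ := exists_eq_height hs
      have hat := D.isAt_inExit hd y
      rcases le_or_gt 0 (d + t) with h0 | h0
      · refine Or.inr (Or.inl ⟨((height d, height (d + t), y), (t, D.inExit (height d) y), _),
          ⟨?_, rfl, hat.extFlow_eq (D.isAt_inExit h0 y)⟩, rfl⟩)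
        simp only [coe_height hd, coe_height h0, sub_sub_cancel, ← Real.exp_add]
        congr 1; ring
      · have ht : t < 0 := by linarith
        have hθ : d / -t ∈ unitInterval :=
          ⟨div_nonneg hd (by linarith), (div_le_one (by linarith)).2 (by linarith)⟩
        have e : -(d / -t * t) = d := by rw [div_neg, neg_mul, neg_neg, div_mul_cancel₀ _ ht.ne]
        refine Or.inl ⟨((⟨d / -t, hθ⟩, ⟨y.1, y.2.1⟩), (t, D.inExit (height d) y), _),
          ⟨?_, ?_⟩, rfl⟩
        · simpa only [e] using hat
        · simpa only [e] using hat.extFlow t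
    · by_cases hs : s = 1
      · subst hs
        exact Or.inr (Or.inr ⟨((1, 1, y), (t, D.inEntrance 1 y), _),
          ⟨by simp, rfl, D.extFlow_inEntrance_one t y⟩, rfl⟩)
      obtain ⟨d, hd, rfl⟩ := exists_eq_height hs
      have hat := D.isAt_inEntrance hd y
      rcases le_or_gt 0 (d - t) with h0 | h0
      · refine Or.inr (Or.inr ⟨((height d, height (d - t), y), (t, D.inEntrance (height d) y), _),
          ⟨?_, rfl, hat.extFlow_eq ?_⟩, rfl⟩)
        · simp only [coe_height hd, coe_height h0, sub_sub_cancel, ← Real.exp_add]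
          congr 1; ring
        · convert D.isAt_inEntrance h0 y using 1
          ring
      · have ht : 0 < t := by linarith
        have hθ : d / t ∈ unitInterval :=
          ⟨div_nonneg hd ht.le, (div_le_one ht).2 (by linarith)⟩
        have e : -(d / t * t) = -d := by field_simp
        refine Or.inl ⟨((⟨d / t, hθ⟩, ⟨y.1, y.2.1⟩), (t, D.inEntrance (height d) y), _),
          ⟨?_, ?_⟩, rfl⟩
        · simpa only [e] using hat
        · simpa only [e] using hat.extFlow t
  · have hlevel : ∀ {σ σ' : unitInterval} {a : ℝ}, 1 - (σ' : ℝ) = (1 - σ) * Real.exp a →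
        (σ = 1 ∧ σ' = 1) ∨ ∃ d, 0 ≤ d ∧ 0 ≤ d - a ∧ σ = height d ∧ σ' = height (d - a) := by
      intro σ σ' a h
      by_cases hσ : σ = 1
      · refine Or.inl ⟨hσ, Subtype.ext ?_⟩
        rw [hσ] at h
        simp only [Icc.coe_one, sub_self, zero_mul] at h ⊢
        linarith
      · obtain ⟨d, hd, rfl⟩ := exists_eq_height hσ
        rw [coe_height hd, sub_sub_cancel, ← Real.exp_add] at h
        have h0 : 0 ≤ d - a := by
          have : Real.exp (-d + a) ≤ 1 := by linarith [σ'.2.1]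
          linarith [Real.exp_le_one_iff.1 this]
        refine Or.inr ⟨d, hd, h0, rfl, Subtype.ext ?_⟩
        rw [coe_height h0, show -(d - a) = -d + a by ring]
        linarith
    rintro (⟨⟨⟨θ, x⟩, _⟩, ⟨h1, h2⟩, rfl⟩ | ⟨⟨⟨σ, σ', y⟩, _⟩, ⟨h1, hp, hq⟩, rfl⟩ |
      ⟨⟨⟨σ, σ', y⟩, _⟩, ⟨h1, hp, hq⟩, rfl⟩)
    · exact (h1.extFlow_eq h2).symm
    · simp only at h1 hp hq
      subst hp hq
      rcases hlevel h1 with ⟨rfl, rfl⟩ | ⟨d, hd, h0, rfl, rfl⟩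
      · exact (D.extFlow_inExit_one _ _).symm
      · refine ((D.isAt_inExit hd y).extFlow_eq ?_).symm
        convert D.isAt_inExit h0 y using 1
        ring
    · simp only at h1 hp hq
      subst hp hq
      rcases hlevel h1 with ⟨rfl, rfl⟩ | ⟨d, hd, h0, rfl, rfl⟩
      · exact (D.extFlow_inEntrance_one _ _).symm
      · refine ((D.isAt_inEntrance hd y).extFlow_eq ?_).symm
        convert D.isAt_inEntrance h0 y using 1
        ring

theorem continuous_of_isClosed_graph {X K : Type*} [TopologicalSpace X] [TopologicalSpace K]
    [CompactSpace K] {f : X → K} (h : IsClosed {q : X × K | q.2 = f q.1}) : Continuous f := by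
  refine continuous_iff_isClosed.2 fun C hC => ?_
  have := isClosedMap_fst_of_compactSpace (X := X) (Y := K) _ (h.inter (hC.preimage continuous_snd))
  convert this using 1
  ext x
  constructor
  · exact fun hx => ⟨(x, f x), ⟨rfl, hx⟩, rfl⟩
  · rintro ⟨⟨x, y⟩, ⟨hy, hC⟩, rfl⟩
    have hy : y = f x := hy
    subst hy
    exact hC

/-- The extended flow as a continuous flow on the extended phase space. -/
def flow : Flow ℝ D.Ext where
  toFun := D.extFlow
  cont' := continuous_of_isClosed_graph D.isClosed_graph_extFlow
  map_add' := D.extFlow_add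
  map_zero' := D.extFlow_zero

theorem coe_flow : ⇑D.flow = D.extFlow := rfl

/-! ### The boundary of the extended phase space -/

theorem isClosed_extBoundary {E : Set Y} (hE : IsClosed E) : IsClosed (D.extBoundary E) := by
  have h₀ := (((hE.preimage (continuous_subtype_val (p := (· ∈ D.B)))).isCompact).image
    D.continuous_inB).isClosed
  have h₁ := (((hE.preimage ((continuous_subtype_val (p := (· ∈ entranceSet φ D.B))).comp
    (continuous_snd (X := unitInterval)))).isCompact).image D.continuous_inEntrance).isClosed
  have h₂ := (((hE.preimage ((continuous_subtype_val (p := (· ∈ exitSet φ D.B))).comp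
    (continuous_snd (X := unitInterval)))).isCompact).image D.continuous_inExit).isClosed
  convert h₀.union (h₁.union h₂) using 1
  ext p
  constructor
  · rintro (⟨x, hx, rfl⟩ | ⟨s, x, hx, rfl⟩ | ⟨s, x, hx, rfl⟩)
    · exact Or.inl ⟨x, hx, rfl⟩
    · exact Or.inr (Or.inl ⟨(s, x), hx, rfl⟩)
    · exact Or.inr (Or.inr ⟨(s, x), hx, rfl⟩)
  · rintro (⟨x, hx, rfl⟩ | ⟨⟨s, x⟩, hx, rfl⟩ | ⟨⟨s, x⟩, hx, rfl⟩)
    · exact Or.inl ⟨x, hx, rfl⟩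
    · exact Or.inr (Or.inl ⟨s, x, hx, rfl⟩)
    · exact Or.inr (Or.inr ⟨s, x, hx, rfl⟩)

theorem isInvariant_extBoundary {E : Set Y} (hE : IsInvariant φ E) :
    IsInvariant D.flow (D.extBoundary E) := by
  have key : ∀ {x : ↥D.B} {t p}, x.1 ∈ E → D.IsAt x t p → p ∈ D.extBoundary E := by
    rintro x t p hx ⟨c, hc, ⟨rfl, y, hy, rfl⟩ | ⟨-, y, hy, rfl⟩ | ⟨-, y, hy, rfl⟩⟩
    · exact Or.inl ⟨y, hy ▸ hE _ hx, rfl⟩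
    · exact Or.inr (Or.inr ⟨_, y, hy ▸ hE _ hx, rfl⟩)
    · exact Or.inr (Or.inl ⟨_, y, hy ▸ hE _ hx, rfl⟩)
  rintro t p (⟨x, hx, rfl⟩ | ⟨s, x, hx, rfl⟩ | ⟨s, x, hx, rfl⟩)
  · exact key hx ((D.isAt_inB x).extFlow t)
  · by_cases hs : s = 1
    · subst hs
      exact Or.inr (Or.inl ⟨1, x, hx, D.extFlow_inEntrance_one t x⟩)
    · obtain ⟨d, hd, rfl⟩ := exists_eq_height hs
      exact key hx ((D.isAt_inEntrance hd x).extFlow t)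
  · by_cases hs : s = 1
    · subst hs
      exact Or.inr (Or.inr ⟨1, x, hx, D.extFlow_inExit_one t x⟩)
    · obtain ⟨d, hd, rfl⟩ := exists_eq_height hs
      exact key hx ((D.isAt_inExit hd x).extFlow t)

end Closed

end ErsatzData

/-! ### Limit sets of the extended flow -/

/-- The limit sets of a point of `S` are nonempty subsets of `S`, provided its orbit stays in a
compact set. -/
theorem disjoint_dynComplement {Y : Type u} [TopologicalSpace Y] {φ : Flow ℝ Y} {B S : Set Y}
    (hB : IsClosed B) (hS : IsClosed S) (hSi : IsInvariant φ S)
    (h : IsIsolatingNhd φ B (dynComplement φ S)) : Disjoint (dynComplement φ S) S := by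
  refine disjoint_left.2 fun y hy hyS => ?_
  have hcl : ∀ {K : Set Y}, IsClosed K → (∀ t, φ t y ∈ K) →
      closure (image2 φ univ {y}) ⊆ K := fun hK h => by
    refine hK.closure_subset_iff.2 ?_
    rintro _ ⟨t, -, _, rfl, rfl⟩
    exact h t
  have hyB : y ∈ Inv φ B := h.inv_eq ▸ hy
  obtain ⟨z, hz⟩ := nonempty_omegaLimit_of_isCompact_absorbing atTop φ {y} h.isCompact
    ⟨univ, univ_mem, hcl hB hyB⟩ (singleton_nonempty y)
  have hzS : z ∈ S := hcl hS (fun t => hSi t hyS)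
    (omegaLimit_subset_closure_image2 _ _ _ univ_mem hz)
  exact eq_empty_iff_forall_notMem.1 hy.2 z ⟨hz, hzS⟩

namespace ErsatzData

variable {Y : Type u} [TopologicalSpace Y] {φ : Flow ℝ Y} (D : ErsatzData φ)

theorem embed_bMinus {p : D.Ext} (h : p ∈ D.bMinus) : (D.embed p).2 = -1 := by
  obtain ⟨y, rfl⟩ := h
  simp [embed_inExit]

theorem embed_bPlus {p : D.Ext} (h : p ∈ D.bPlus) : (D.embed p).2 = 1 := by
  obtain ⟨y, rfl⟩ := h
  simp [embed_inEntrance]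

theorem embed_lift {R : Set Y} {p : D.Ext} (h : p ∈ D.lift R) :
    (D.embed p).2 = 0 ∧ (D.embed p).1 ∈ R := by
  obtain ⟨x, hx, rfl⟩ := h
  exact ⟨rfl, hx⟩

theorem disjoint_lift_bMinus (R : Set Y) : Disjoint (D.lift R) D.bMinus :=
  disjoint_left.2 fun p h h' => by
    have := (D.embed_lift h).1.symm.trans (D.embed_bMinus h')
    norm_num at this

theorem disjoint_lift_bPlus (A : Set Y) : Disjoint (D.lift A) D.bPlus :=
  disjoint_left.2 fun p h h' => by
    have := (D.embed_lift h).1.symm.trans (D.embed_bPlus h')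
    norm_num at this

theorem tendsto_height_atTop : Tendsto (fun t => (height t : ℝ)) atTop (𝓝 1) := by
  have h : Tendsto (fun t : ℝ => 1 - Real.exp (-t)) atTop (𝓝 (1 - 0)) :=
    (Real.tendsto_exp_neg_atTop_nhds_zero).const_sub 1
  rw [sub_zero] at h
  refine h.congr' ?_
  filter_upwards [eventually_ge_atTop 0] with t ht
  rw [coe_height ht]

section

variable [T2Space Y]

variable {D} in
/-- Points on the same orbit have the same limit sets. -/
theorem IsAt.limits_eq {x : ↥D.B} {a : ℝ} {p : D.Ext} (h : D.IsAt x a p) :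
    omegaLim D.flow p = omegaLim D.flow (D.inB x) ∧
      alphaLim D.flow p = alphaLim D.flow (D.inB x) := by
  have e : D.flow a (D.inB x) = p := (D.isAt_inB x).extFlow_eq (by rwa [zero_add])
  have h1 := D.flow.omegaLimit_image_eq (s := {D.inB x}) atTop
    (fun t => tendsto_atTop_add_const_right _ t tendsto_id) a
  have h2 := D.flow.omegaLimit_image_eq (s := {D.inB x}) atBot
    (fun t => tendsto_atBot_add_const_right _ t tendsto_id) a
  rw [image_singleton, e] at h1 h2
  exact ⟨h1, h2⟩

/-- If the height of the embedded orbit converges, the limit is the height of every limit point. -/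
theorem embed_limit {f : Filter ℝ} {p q : D.Ext} {c : ℝ} (hq : q ∈ omegaLimit f D.flow {p})
    (hc : Tendsto (fun t => (D.embed (D.flow t p)).2) f (𝓝 c)) : (D.embed q).2 = c := by
  have h1 := (mem_omegaLimit_singleton_iff_mapClusterPt _ _ _ _).1 hq
  have h2 : MapClusterPt (D.embed q).2 f (fun t => (D.embed (D.flow t p)).2) :=
    h1.continuousAt_comp
      (f := fun z => (D.embed z).2) (continuous_snd.comp D.continuous_embed).continuousAt
  exact eq_of_nhds_neBot (ClusterPt.mono h2 hc)

theorem flow_inB {x : ↥D.B} {t : ℝ} (h : ∀ s ∈ uIcc 0 t, φ s x.1 ∈ D.B) :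
    D.flow t (D.inB x) = D.inB ⟨φ t x.1, h t right_mem_uIcc⟩ :=
  flowB_eq_inB h rfl

theorem embed_omegaLim_of_stays {x : ↥D.B} {q : D.Ext} (hq : q ∈ omegaLim D.flow (D.inB x))
    (h : ∀ t, 0 ≤ t → φ t x.1 ∈ D.B) : (D.embed q).2 = 0 := by
  refine D.embed_limit hq (tendsto_const_nhds.congr' ?_)
  filter_upwards [eventually_ge_atTop 0] with t ht
  rw [D.flow_inB fun s hs => h s (by rw [uIcc_of_le ht] at hs; exact hs.1), embed_inB]

theorem embed_alphaLim_of_stays {x : ↥D.B} {q : D.Ext} (hq : q ∈ alphaLim D.flow (D.inB x))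
    (h : ∀ t, t ≤ 0 → φ t x.1 ∈ D.B) : (D.embed q).2 = 0 := by
  refine D.embed_limit hq (tendsto_const_nhds.congr' ?_)
  filter_upwards [eventually_le_atBot 0] with t ht
  rw [D.flow_inB fun s hs => h s (by rw [uIcc_of_ge ht] at hs; exact hs.2), embed_inB]

theorem embed_omegaLim_of_leaves {x : ↥D.B} {q : D.Ext} (hq : q ∈ omegaLim D.flow (D.inB x))
    {t₀ : ℝ} (ht₀ : 0 ≤ t₀) (h : φ t₀ x.1 ∉ D.B) : (D.embed q).2 = -1 := by
  have hs := exitTime_spec D.block.isClosed x.2 (t := t₀) fun h' => h (h' t₀ ⟨ht₀, le_rfl⟩)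
  set c := exitTime φ D.B x.1
  refine D.embed_limit hq ?_
  have h1 : Tendsto (fun t => -(height (t - c) : ℝ)) atTop (𝓝 (-1)) :=
    (tendsto_height_atTop.comp (tendsto_atTop_add_const_right _ (-c) tendsto_id)).neg
  refine h1.congr' ?_
  filter_upwards [eventually_ge_atTop c] with t ht
  have : D.IsAt x t (D.inExit (height (t - c)) ⟨_, hs.2⟩) := by
    refine ⟨c, ?_, Or.inr (Or.inl ⟨ht, ⟨_, hs.2⟩, rfl, rfl⟩)⟩
    rw [uIcc_of_le exitTime_nonneg]
    exact mem_of_le_exitTime x.2 hs.2.1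
  have e : D.flow t (D.inB x) = _ := this.eq_flowB
  rw [e, embed_inExit]

theorem embed_alphaLim_of_leaves {x : ↥D.B} {q : D.Ext} (hq : q ∈ alphaLim D.flow (D.inB x))
    {t₀ : ℝ} (ht₀ : t₀ ≤ 0) (h : φ t₀ x.1 ∉ D.B) : (D.embed q).2 = 1 := by
  have hs := entranceTime_spec D.block.isClosed x.2 (t := t₀) fun h' => h (h' t₀ ⟨le_rfl, ht₀⟩)
  set c := entranceTime φ D.B x.1
  refine D.embed_limit hq ?_
  have h1 : Tendsto (fun t => (height (c - t) : ℝ)) atBot (𝓝 1) :=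
    tendsto_height_atTop.comp (tendsto_atTop_add_const_left _ c tendsto_neg_atBot_atTop)
  refine h1.congr' ?_
  filter_upwards [eventually_le_atBot c] with t ht
  have : D.IsAt x t (D.inEntrance (height (c - t)) ⟨_, hs.2⟩) := by
    refine ⟨c, ?_, Or.inr (Or.inr ⟨ht, ⟨_, hs.2⟩, rfl, rfl⟩)⟩
    rw [uIcc_of_ge entranceTime_nonpos]
    exact mem_of_entranceTime_le x.2 hs.2.1
  have e : D.flow t (D.inB x) = _ := this.eq_flowB
  rw [e, embed_inEntrance]

/-- If the orbit of `x` is eventually in `B`, then limit points under the original flow are limit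
points under the extended flow. -/
theorem inB_mem_omegaLimit {f : Filter ℝ} {x : ↥D.B} {y : Y} (hy : y ∈ omegaLimit f φ {x.1})
    (h : ∀ᶠ t in f, ∀ s ∈ uIcc 0 t, φ s x.1 ∈ D.B) :
    ∃ hyB : y ∈ D.B, D.inB ⟨y, hyB⟩ ∈ omegaLimit f D.flow {D.inB x} := by
  have h1 := (mem_omegaLimit_singleton_iff_mapClusterPt _ _ _ _).1 hy
  rw [mapClusterPt_iff_frequently] at h1
  have hyB : y ∈ D.B := by
    by_contra hn
    obtain ⟨t, ht, ht'⟩ := ((h1 _ (D.block.isClosed.isOpen_compl.mem_nhds hn)).and_eventually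
      h).exists
    exact ht (ht' t right_mem_uIcc)
  refine ⟨hyB, (mem_omegaLimit_singleton_iff_mapClusterPt _ _ _ _).2
    (mapClusterPt_iff_frequently.2 fun O hO => ?_)⟩
  have h2 := D.continuous_inB.continuousAt hO
  rw [mem_map, mem_nhds_subtype] at h2
  obtain ⟨V, hV, hVO⟩ := h2
  refine ((h1 V hV).and_eventually h).mono fun t ⟨ht, ht'⟩ => ?_
  rw [D.flow_inB ht']
  exact hVO (show (⟨φ t x.1, _⟩ : ↥D.B) ∈ Subtype.val ⁻¹' V from ht)

theorem omegaLim_subset_of_stays {x : ↥D.B} {A : Set Y} (h : ∀ t, 0 ≤ t → φ t x.1 ∈ D.B)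
    (hA : omegaLim D.flow (D.inB x) ⊆ D.lift A) : omegaLim φ x.1 ⊆ A := by
  intro y hy
  obtain ⟨hyB, hy'⟩ := D.inB_mem_omegaLimit hy (by
    filter_upwards [eventually_ge_atTop 0] with t ht s hs
    exact h s (by rw [uIcc_of_le ht] at hs; exact hs.1))
  exact (D.embed_lift (hA hy')).2

theorem alphaLim_subset_of_stays {x : ↥D.B} {A : Set Y} (h : ∀ t, t ≤ 0 → φ t x.1 ∈ D.B)
    (hA : alphaLim D.flow (D.inB x) ⊆ D.lift A) : alphaLim φ x.1 ⊆ A := by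
  intro y hy
  obtain ⟨hyB, hy'⟩ := D.inB_mem_omegaLimit hy (by
    filter_upwards [eventually_le_atBot 0] with t ht s hs
    exact h s (by rw [uIcc_of_ge ht] at hs; exact hs.2))
  exact (D.embed_lift (hA hy')).2

/-! ### Connections to and from infinity -/

variable {D} {S : Set Y}

/-- An orbit of the extended flow from `R` to `b⁻` leaves `B`, so its points are not in the
dynamical complement of `S`; as their `α`-limit sets miss `S`, their `ω`-limit sets meet it. -/
theorem exists_connection_out (hS : IsClosed S) (hSi : IsInvariant φ S)
    (hD : IsIsolatingNhd φ D.B (dynComplement φ S)) {R : Set Y} (hR : R ⊆ dynComplement φ S)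
    {p : D.Ext} (hpb : p ∉ D.bMinus) (hα : alphaLim D.flow p ⊆ D.lift R)
    (hω : (omegaLim D.flow p ∩ D.bMinus).Nonempty) :
    ∃ x ∈ D.B, alphaLim φ x ⊆ R ∧ (omegaLim φ x ∩ S).Nonempty := by
  obtain ⟨a, ha⟩ : (alphaLim D.flow p).Nonempty :=
    nonempty_omegaLimit atBot D.flow {p} (singleton_nonempty p)
  obtain ⟨w, hw, hwb⟩ := hω
  rcases D.exists_isAt_or p with ⟨x, c, h⟩ | ⟨y, rfl⟩ | ⟨y, rfl⟩
  · rw [h.limits_eq.1] at hw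
    rw [h.limits_eq.2] at hα ha
    have hstay : ∀ t, t ≤ 0 → φ t x.1 ∈ D.B := fun t ht => by
      by_contra hn
      have := (D.embed_alphaLim_of_leaves ha ht hn).symm.trans (D.embed_lift (hα ha)).1
      norm_num at this
    have hαR := D.alphaLim_subset_of_stays hstay hα
    refine ⟨x.1, x.2, hαR, ?_⟩
    by_contra hne
    have hx : x.1 ∈ dynComplement φ S :=
      ⟨((disjoint_dynComplement D.block.isClosed hS hSi hD).mono_left
        (hαR.trans hR)).inter_eq, not_nonempty_iff_eq_empty.1 hne⟩
    rw [← hD.inv_eq] at hx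
    have := (D.embed_omegaLim_of_stays hw fun t _ => hx t).symm.trans (D.embed_bMinus hwb)
    norm_num at this
  · exact (hpb ⟨y, rfl⟩).elim
  · have h1 : (D.embed a).2 = 1 := D.embed_limit ha (tendsto_const_nhds.congr fun t => by
      rw [coe_flow, extFlow_inEntrance_one, embed_inEntrance, Icc.coe_one])
    have := h1.symm.trans (D.embed_lift (hα ha)).1
    norm_num at this

/-- An orbit of the extended flow from `b⁺` to `A` enters `B` from outside, so its points are not in
the dynamical complement of `S`; as their `ω`-limit sets miss `S`, their `α`-limit sets meet it. -/
theorem exists_connection_in (hS : IsClosed S) (hSi : IsInvariant φ S)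
    (hD : IsIsolatingNhd φ D.B (dynComplement φ S)) {A : Set Y} (hA : A ⊆ dynComplement φ S)
    {p : D.Ext} (hpb : p ∉ D.bPlus) (hω : omegaLim D.flow p ⊆ D.lift A)
    (hα : alphaLim D.flow p ⊆ D.bPlus) :
    ∃ x ∈ D.B, omegaLim φ x ⊆ A ∧ (alphaLim φ x ∩ S).Nonempty := by
  obtain ⟨a, ha⟩ : (alphaLim D.flow p).Nonempty :=
    nonempty_omegaLimit atBot D.flow {p} (singleton_nonempty p)
  obtain ⟨w, hw⟩ : (omegaLim D.flow p).Nonempty :=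
    nonempty_omegaLimit atTop D.flow {p} (singleton_nonempty p)
  rcases D.exists_isAt_or p with ⟨x, c, h⟩ | ⟨y, rfl⟩ | ⟨y, rfl⟩
  · rw [h.limits_eq.1] at hω hw
    rw [h.limits_eq.2] at hα ha
    have hstay : ∀ t, 0 ≤ t → φ t x.1 ∈ D.B := fun t ht => by
      by_contra hn
      have := (D.embed_omegaLim_of_leaves hw ht hn).symm.trans (D.embed_lift (hω hw)).1
      norm_num at this
    have hωA := D.omegaLim_subset_of_stays hstay hω
    refine ⟨x.1, x.2, hωA, ?_⟩
    by_contra hne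
    have hx : x.1 ∈ dynComplement φ S :=
      ⟨not_nonempty_iff_eq_empty.1 hne, ((disjoint_dynComplement D.block.isClosed hS hSi
        hD).mono_left (hωA.trans hA)).inter_eq⟩
    rw [← hD.inv_eq] at hx
    have := (D.embed_alphaLim_of_stays ha fun t _ => hx t).symm.trans (D.embed_bPlus (hα ha))
    norm_num at this
  · have h1 : (D.embed w).2 = -1 := D.embed_limit hw (tendsto_const_nhds.congr fun t => by
      rw [coe_flow, extFlow_inExit_one, embed_inExit, Icc.coe_one])
    have := h1.symm.trans (D.embed_lift (hω hw)).1
    norm_num at this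
  · exact (hpb ⟨y, rfl⟩).elim

end

end ErsatzData

instance (X : Type u) [NormedAddCommGroup X] [InnerProductSpace ℝ X] : T2Space (Hemisphere X) :=
  inferInstanceAs (T2Space {p : X × ℝ // inner ℝ p.1 p.1 + p.2 ^ 2 = 1 ∧ 0 ≤ p.2})

theorem isClosed_equator (X : Type u) [NormedAddCommGroup X] [InnerProductSpace ℝ X] :
    IsClosed (equator X) :=
  isClosed_eq (continuous_snd.comp continuous_subtype_val) continuous_const

end PoincareConley

end

theorem theorem4p7 {X : Type u} [NormedAddCommGroup X] [InnerProductSpace ℝ X]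
    [FiniteDimensional ℝ X]
    (φ : Flow ℝ (Hemisphere X)) (hE : IsInvariant φ (equator X))
    (S : Set (Hemisphere X)) (hSE : S ⊆ equator X) (hS : IsClosed S) (hSinv : IsInvariant φ S)
    (hcomp : IsIsolatedInvariant φ (dynComplement φ S))
    (D : ErsatzData φ) (hD : IsIsolatingNhd φ D.B (dynComplement φ S)) :
    (∀ (R : Set (Hemisphere X)) (I : Set D.Ext) (hI hR hb : IndexTriple.{u}),
      R ⊆ dynComplement φ S →
      IsIsolatedInvariant D.extFlow (D.lift R) →
      IsIsolatedInvariant D.extFlow I →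
      D.lift R ∪ D.bMinus ⊆ I →
      IsAttractorRepeller D.extFlow I D.bMinus (D.lift R) →
      IsConleyIndex D.extFlow (D.extBoundary (equator X)) I hI →
      IsConleyIndex D.extFlow (D.extBoundary (equator X)) (D.lift R) hR →
      IsConleyIndex D.extFlow (D.extBoundary (equator X)) D.bMinus hb →
      ¬ hI.HEquiv (hR.wedge hb) →
      ∃ x ∈ D.B, alphaLim φ x ⊆ R ∧ (omegaLim φ x ∩ S).Nonempty) ∧
    (∀ (A : Set (Hemisphere X)) (I : Set D.Ext) (hI hA hb : IndexTriple.{u}),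
      A ⊆ dynComplement φ S →
      IsIsolatedInvariant D.extFlow (D.lift A) →
      IsIsolatedInvariant D.extFlow I →
      D.lift A ∪ D.bPlus ⊆ I →
      IsAttractorRepeller D.extFlow I (D.lift A) D.bPlus →
      IsConleyIndex D.extFlow (D.extBoundary (equator X)) I hI →
      IsConleyIndex D.extFlow (D.extBoundary (equator X)) (D.lift A) hA →
      IsConleyIndex D.extFlow (D.extBoundary (equator X)) D.bPlus hb →
      ¬ hI.HEquiv (hA.wedge hb) →
      ∃ x ∈ D.B, omegaLim φ x ⊆ A ∧ (alphaLim φ x ∩ S).Nonempty) := by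
  have hbd := D.isClosed_extBoundary (isClosed_equator X)
  have hbi := D.isInvariant_extBoundary hE
  rw [← D.coe_flow]
  constructor
  · rintro R I hI hR hb hRS - ⟨K, hK⟩ hsub har iI iR ib hne
    by_cases h : I ⊆ D.lift R ∪ D.bMinus
    · obtain rfl := h.antisymm hsub
      exact (hne (iI.hEquiv_wedge hbd hbi (D.disjoint_lift_bMinus R) iR ib)).elim
    · obtain ⟨p, hpI, hp⟩ := not_subset.1 h
      obtain ⟨hpR, hpb⟩ := not_or.1 hp
      refine ErsatzData.exists_connection_out hS hSinv hD hRS hpb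
        (har.alphaLim_subset hK.isClosed hK.isInvariant hpI hpb) ?_
      rw [har.repeller] at hpR
      by_contra hemp
      exact hpR ⟨hpI, not_nonempty_iff_eq_empty.1 hemp⟩
  · rintro A I hI hA hb hAS - ⟨K, hK⟩ hsub har iI iA ib hne
    by_cases h : I ⊆ D.lift A ∪ D.bPlus
    · obtain rfl := h.antisymm hsub
      exact (hne (iI.hEquiv_wedge hbd hbi (D.disjoint_lift_bPlus A) iA ib)).elim
    · obtain ⟨p, hpI, hp⟩ := not_subset.1 h
      obtain ⟨hpA, hpb⟩ := not_or.1 hp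
      refine ErsatzData.exists_connection_in hS hSinv hD hAS hpb
        (har.omegaLim_subset hK.isInvariant hpI ?_)
        (har.alphaLim_subset hK.isClosed hK.isInvariant hpI hpA)
      have hpb' := hpb
      rw [har.repeller] at hpb'
      by_contra hemp
      exact hpb' ⟨hpI, not_nonempty_iff_eq_empty.1 hemp⟩
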